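/- Let $n\ge 2$ be an integer and let $X$ be a random variable with values in $\{0,1,\dots,n\}$, with mean $\mu$, standard deviation $\sigma>0$ and probability generating function $f_X(z)=\sum_{k=0}^{n}\mathbb{P}(X=k)\,z^k$. Put $X^{*}=(X-\mu)/\sigma$. Let $\delta\in(0,1)$ be such that $|1-\zeta|\ge\delta$ for every complex root $\zeta$ of $f_X$. Then $$\sup_{t\in\mathbb{R}}\bigl|\mathbb{P}(X^{*}\le t)-\mathbb{P}(Z\le t)\bigr| = O\!\left(\frac{\log n}{\delta\sigma}\right),$$ where $Z\sim N(0,1)$ is a standard normal random variable and the implicit constant is absolute (it does not depend on $n$, $X$ or $\delta$) and can be taken to be $2^{3261}$. -/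

import Mathlib

open MeasureTheory ProbabilityTheory

noncomputable section

/-- The probability generating function `f_X(z) = ∑_{k=0}^{n} P(X = k) z^k` of a random variable
`X` with values in `{0, …, n}`, as a polynomial over `ℂ`. -/
def pgf {Ω : Type*} [MeasurableSpace Ω] (P : Measure Ω) (n : ℕ) (X : Ω → ℕ) : Polynomial ℂ :=
  ∑ k ∈ Finset.range (n + 1), Polynomial.monomial k ((P.real {ω | X ω = k} : ℝ) : ℂ)

/-- The mean `μ = E X`. -/
def mean {Ω : Type*} [MeasurableSpace Ω] (P : Measure Ω) (X : Ω → ℕ) : ℝ :=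
  ∫ ω, (X ω : ℝ) ∂P

/-- The standard deviation `σ = √(Var X)`. -/
def stdDev {Ω : Type*} [MeasurableSpace Ω] (P : Measure Ω) (X : Ω → ℕ) : ℝ :=
  Real.sqrt (variance (fun ω => (X ω : ℝ)) P)

/-- The normalized random variable `X* = (X - μ) / σ`. -/
def normalized {Ω : Type*} [MeasurableSpace Ω] (P : Measure Ω) (X : Ω → ℕ) : Ω → ℝ :=
  fun ω => ((X ω : ℝ) - mean P X) / stdDev P X

/-- The Kolmogorov distance `sup_t |ν₁((-∞, t]) - ν₂((-∞, t])|` of two laws on `ℝ`. For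
probability measures the supremum is over a nonempty set of reals bounded by `1`. -/
def kolmogorovDist (ν₁ ν₂ : Measure ℝ) : ℝ :=
  ⨆ t : ℝ, |ν₁.real (Set.Iic t) - ν₂.real (Set.Iic t)|

end

/-!
Near the origin `f_X (e ^ z) = E e ^ (z X)` has no zeros, so it equals `exp φ` with `φ` holomorphic
on the disc of radius `ρ = δ / 4` and `|φ'| ≤ n / ρ`. Since `|E e ^ (z X)| ≤ E e ^ (Re z * X)`,
along vertical lines `Re φ` is largest on the real axis. Comparing `φ` with its reflection in a
horizontal line at height `b` shows that `Im φ'` can be negative at that height only by an amount of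
order `(n / ρ) e ^ (-c ρ / b)`, which is `O (1 / ρ)` as soon as `b` is at most of order `ρ / log n`.
A function which is real on the real axis and has nonnegative imaginary part in the upper half disc
has its Taylor coefficients controlled by the linear one, here `φ'' 0 = σ ^ 2`. Hence
`φ z = μ z + σ ^ 2 z ^ 2 / 2 + O (σ ^ 2 (log n / ρ) |z| ^ 3)` for `|z|` up to order `ρ / log n`, and
Esseen's smoothing inequality turns this into the bound `O (log n / (ρ σ))`.
-/

section Smoothing

open Set
open scoped NNReal

/-- The Fejér kernel `(1 - cos v) / v ^ 2`, written as the Fourier transform of the triangle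
function so that it has the right value at `v = 0`; it is the smoothing kernel in Esseen's
inequality. It is not normalized: its mass on `ℝ` is `π`. -/
noncomputable def fejerKernel (v : ℝ) : ℝ := ∫ t in (0 : ℝ)..1, (1 - t) * Real.cos (t * v)

lemma fejerKernel_eq {v : ℝ} (hv : v ≠ 0) : fejerKernel v = (1 - Real.cos v) / v ^ 2 := by
  have h (t : ℝ) : HasDerivAt
      (fun t : ℝ => (1 - t) * (Real.sin (t * v) / v) - Real.cos (t * v) / v ^ 2)
      ((1 - t) * Real.cos (t * v)) t := by
    have h0 : HasDerivAt (fun t : ℝ => t * v) v t := by simpa using (hasDerivAt_id t).mul_const v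
    refine ((((hasDerivAt_id t).const_sub 1).mul (h0.sin.div_const v)).sub
      (h0.cos.div_const (v ^ 2))).congr_deriv ?_
    simp only [id]
    field_simp
    ring
  rw [fejerKernel, intervalIntegral.integral_eq_sub_of_hasDerivAt (fun t _ => h t)
    (Continuous.intervalIntegrable (by fun_prop) _ _)]
  simp
  ring

lemma fejerKernel_neg (v : ℝ) : fejerKernel (-v) = fejerKernel v := by
  simp [fejerKernel]

lemma fejerKernel_nonneg (v : ℝ) : 0 ≤ fejerKernel v := by
  rcases eq_or_ne v 0 with rfl | hv
  · exact intervalIntegral.integral_nonneg zero_le_one fun t ht => by simp [ht.2]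
  · rw [fejerKernel_eq hv]
    exact div_nonneg (sub_nonneg.2 (Real.cos_le_one v)) (sq_nonneg v)

lemma continuous_fejerKernel : Continuous fejerKernel :=
  intervalIntegral.continuous_parametric_intervalIntegral_of_continuous' (by fun_prop) 0 1

lemma integral_one_sub_zero_one : ∫ t in (0 : ℝ)..1, (1 - t) = 1 / 2 := by
  rw [intervalIntegral.integral_sub (by simp) (by simp)]
  norm_num

lemma fejerKernel_le_one (v : ℝ) : fejerKernel v ≤ 1 := by
  have : fejerKernel v ≤ ∫ t in (0 : ℝ)..1, (1 - t) :=
    intervalIntegral.integral_mono_on zero_le_one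
      (Continuous.intervalIntegrable (by fun_prop) _ _)
      (Continuous.intervalIntegrable (by fun_prop) _ _)
      fun t ht => mul_le_of_le_one_right (sub_nonneg.2 ht.2) (Real.cos_le_one _)
  rw [integral_one_sub_zero_one] at this
  linarith

lemma fejerKernel_le_two_div_sq {v : ℝ} (hv : v ≠ 0) : fejerKernel v ≤ 2 / v ^ 2 := by
  rw [fejerKernel_eq hv]
  gcongr
  linarith [Real.neg_one_le_cos v]

lemma quarter_le_fejerKernel {v : ℝ} (hv : |v| ≤ 1) : 1 / 4 ≤ fejerKernel v := by
  have : ∫ t in (0 : ℝ)..1, (1 - t) * (1 / 2) ≤ fejerKernel v := by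
    refine intervalIntegral.integral_mono_on zero_le_one
      (Continuous.intervalIntegrable (by fun_prop) _ _)
      (Continuous.intervalIntegrable (by fun_prop) _ _) fun t ht => ?_
    have htv : (t * v) ^ 2 ≤ 1 := by
      rw [sq_le_one_iff_abs_le_one, abs_mul, abs_of_nonneg ht.1]
      exact mul_le_one₀ ht.2 (abs_nonneg v) hv
    exact mul_le_mul_of_nonneg_left
      (by linarith [Real.one_sub_sq_div_two_le_cos (x := t * v)]) (sub_nonneg.2 ht.2)
  rw [intervalIntegral.integral_mul_const, integral_one_sub_zero_one] at this
  linarith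

lemma integrable_fejerKernel : Integrable fejerKernel := by
  refine (integrable_inv_one_add_sq.const_mul 4).mono'
    continuous_fejerKernel.aestronglyMeasurable (ae_of_all _ fun v => ?_)
  rw [Real.norm_of_nonneg (fejerKernel_nonneg v), ← div_eq_mul_inv, le_div_iff₀ (by positivity)]
  have h1 := fejerKernel_le_one v
  rcases eq_or_ne v 0 with rfl | hv
  · linarith
  · have h2 := fejerKernel_le_two_div_sq hv
    rw [le_div_iff₀ (by positivity)] at h2
    linarith

lemma setIntegral_fejerKernel_Ioi_le {h : ℝ} (hh : 0 < h) :
    ∫ v in Ioi h, fejerKernel v ≤ 2 / h := by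
  have hi : IntegrableOn (fun v : ℝ => v ^ (-2 : ℝ)) (Ioi h) :=
    integrableOn_Ioi_rpow_of_lt (by norm_num) hh
  calc ∫ v in Ioi h, fejerKernel v ≤ ∫ v in Ioi h, 2 * v ^ (-2 : ℝ) := by
        refine setIntegral_mono_on integrable_fejerKernel.integrableOn (hi.const_mul 2)
          measurableSet_Ioi fun v hv => ?_
        have hv0 : 0 < v := hh.trans hv
        rw [Real.rpow_neg hv0.le, Real.rpow_two, ← div_eq_mul_inv]
        exact fejerKernel_le_two_div_sq hv0.ne'
    _ = 2 / h := by
        rw [integral_const_mul, integral_Ioi_rpow_of_lt (by norm_num) hh,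
          show (-2 : ℝ) + 1 = -1 by norm_num, Real.rpow_neg_one]
        ring

lemma setIntegral_fejerKernel_compl_Icc_le {h : ℝ} (hh : 0 < h) :
    ∫ v in (Icc (-h) h)ᶜ, fejerKernel v ≤ 4 / h := by
  have hneg : ∫ v in Iio (-h), fejerKernel v = ∫ v in Ioi h, fejerKernel v := by
    simpa only [fejerKernel_neg, integral_Iic_eq_integral_Iio]
      using (integral_comp_neg_Ioi h fejerKernel).symm
  have hdisj : Disjoint (Iio (-h)) (Ioi h) := Iio_disjoint_Ioi_of_le (by linarith)
  rw [← Ici_inter_Iic, compl_inter, compl_Ici, compl_Iic,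
    setIntegral_union hdisj measurableSet_Ioi integrable_fejerKernel.integrableOn
      integrable_fejerKernel.integrableOn, hneg]
  have h4 : 4 / h = 2 / h + 2 / h := by ring
  linarith [setIntegral_fejerKernel_Ioi_le hh]

lemma half_le_setIntegral_fejerKernel {h : ℝ} (hh : 1 ≤ h) :
    1 / 2 ≤ ∫ v in Icc (-h) h, fejerKernel v := by
  calc (1 : ℝ) / 2 = ∫ v in Icc (-1 : ℝ) 1, (1 / 4 : ℝ) := by norm_num
    _ ≤ ∫ v in Icc (-1 : ℝ) 1, fejerKernel v :=
        setIntegral_mono_on (by simp) integrable_fejerKernel.integrableOn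
          measurableSet_Icc fun v hv => quarter_le_fejerKernel (abs_le.2 hv)
    _ ≤ _ := setIntegral_mono_set integrable_fejerKernel.integrableOn
        (ae_of_all _ fejerKernel_nonneg)
        (Icc_subset_Icc (neg_le_neg hh) hh).eventuallyLE

lemma integrable_fejerKernel_mul_comp_sub {D : ℝ → ℝ} {η : ℝ} (hD : Measurable D)
    (hη : ∀ x, |D x| ≤ η) (a : ℝ) : Integrable fun v => fejerKernel v * D (a - v) :=
  integrable_fejerKernel.mul_bdd
    (hD.comp (measurable_id.const_sub a)).aestronglyMeasurable (ae_of_all _ fun _ => hη _)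

lemma le_abs_integral_fejerKernel_mul_add {D : ℝ → ℝ} {η h a d : ℝ} (hD : Measurable D)
    (hη : ∀ x, |D x| ≤ η) (hh : 1 ≤ h) (hd : ∀ v ∈ Icc (-h) h, d ≤ D (a - v)) :
    d ≤ 2 * |∫ v, fejerKernel v * D (a - v)| + 8 / h * η := by
  have hη0 : 0 ≤ η := (abs_nonneg _).trans (hη 0)
  rcases le_or_gt d 0 with hd0 | hd0
  · exact hd0.trans (by positivity)
  have hint := integrable_fejerKernel_mul_comp_sub hD hη a
  have hin : d / 2 ≤ ∫ v in Icc (-h) h, fejerKernel v * D (a - v) := by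
    calc d / 2 = 1 / 2 * d := by ring
      _ ≤ (∫ v in Icc (-h) h, fejerKernel v) * d :=
          mul_le_mul_of_nonneg_right (half_le_setIntegral_fejerKernel hh) hd0.le
      _ = ∫ v in Icc (-h) h, fejerKernel v * d := (integral_mul_const _ _).symm
      _ ≤ _ := setIntegral_mono_on (integrable_fejerKernel.integrableOn.mul_const _)
          hint.integrableOn measurableSet_Icc
          fun v hv => mul_le_mul_of_nonneg_left (hd v hv) (fejerKernel_nonneg v)
  have hout : -(4 / h * η) ≤ ∫ v in (Icc (-h) h)ᶜ, fejerKernel v * D (a - v) := by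
    calc -(4 / h * η) ≤ -((∫ v in (Icc (-h) h)ᶜ, fejerKernel v) * η) :=
          neg_le_neg (mul_le_mul_of_nonneg_right
            (setIntegral_fejerKernel_compl_Icc_le (by linarith)) hη0)
      _ = ∫ v in (Icc (-h) h)ᶜ, fejerKernel v * -η := by rw [integral_mul_const, mul_neg]
      _ ≤ _ := setIntegral_mono_on (integrable_fejerKernel.integrableOn.mul_const _)
          hint.integrableOn measurableSet_Icc.compl fun v _ =>
          mul_le_mul_of_nonneg_left (neg_le_of_abs_le (hη _)) (fejerKernel_nonneg v)
  have hsplit := integral_add_compl (measurableSet_Icc (a := -h) (b := h)) hint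
  have h8 : 8 / h * η = 2 * (4 / h * η) := by ring
  linarith [le_abs_self (∫ v, fejerKernel v * D (a - v))]

lemma integral_fejerKernel_mul_cdf (ν : Measure ℝ) [IsProbabilityMeasure ν] (a : ℝ) :
    ∫ v, fejerKernel v * cdf ν (a - v) = ∫ x, (∫ v in Iic (a - x), fejerKernel v) ∂ν := by
  have hmeas : MeasurableSet {z : ℝ × ℝ | z.2 ≤ a - z.1} :=
    measurableSet_le measurable_snd (measurable_fst.const_sub a)
  have hint : Integrable (Function.uncurry fun v x : ℝ => (Iic (a - v)).indicator
      (fun _ => fejerKernel v) x) (volume.prod ν) :=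
    (integrable_fejerKernel.comp_fst ν).indicator hmeas
  calc ∫ v, fejerKernel v * cdf ν (a - v)
      = ∫ v, ∫ x, (Iic (a - v)).indicator (fun _ => fejerKernel v) x ∂ν := by
        congr with v
        rw [integral_indicator measurableSet_Iic, setIntegral_const, cdf_eq_real, smul_eq_mul,
          mul_comm]
    _ = ∫ x, (∫ v, (Iic (a - v)).indicator (fun _ => fejerKernel v) x) ∂ν :=
        integral_integral_swap hint
    _ = _ := by
        congr with x
        rw [← integral_indicator measurableSet_Iic]
        simp only [indicator_apply, mem_Iic, le_sub_comm]

lemma intervalIntegral_fejerKernel (u : ℝ) :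
    ∫ v in (0 : ℝ)..u, fejerKernel v =
      ∫ t in (0 : ℝ)..1, (1 - t) * (Real.sin (t * u) / t) := by
  have hcont : Continuous (Function.uncurry fun v t : ℝ => (1 - t) * Real.cos (t * v)) := by
    fun_prop
  simp only [fejerKernel]
  rw [intervalIntegral_intervalIntegral_swap (hcont.continuousOn.integrableOn_compact
    (isCompact_uIcc.prod isCompact_uIcc) |>.mono_set
      (prod_mono uIoc_subset_uIcc uIoc_subset_uIcc))]
  refine intervalIntegral.integral_congr_ae (ae_of_all _ fun t ht => ?_)
  have ht0 : t ≠ 0 := (uIoc_of_le (zero_le_one' ℝ) ▸ ht).1.ne'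
  rw [intervalIntegral.integral_const_mul, intervalIntegral.integral_comp_mul_left _ ht0,
    integral_cos, mul_zero, Real.sin_zero, sub_zero, smul_eq_mul, inv_mul_eq_div]

lemma abs_sin_mul_div_le_abs (t u : ℝ) : |Real.sin (t * u) / t| ≤ |u| := by
  rcases eq_or_ne t 0 with rfl | ht
  · simp
  · rw [abs_div, div_le_iff₀ (abs_pos.2 ht), mul_comm, ← abs_mul]
    exact Real.abs_sin_le_abs

lemma integrable_prod_sin_mul_div {ν : Measure ℝ} [IsProbabilityMeasure ν]
    (hν : Integrable id ν) (a : ℝ) :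
    Integrable (Function.uncurry fun t x : ℝ => (1 - t) * (Real.sin (t * (a - x)) / t))
      ((volume.restrict (uIoc (0 : ℝ) 1)).prod ν) := by
  have : IsFiniteMeasure (volume.restrict (uIoc (0 : ℝ) 1)) := ⟨by simp [uIoc]⟩
  have hdom : Integrable (fun z : ℝ × ℝ => |a - z.2|)
      ((volume.restrict (uIoc (0 : ℝ) 1)).prod ν) :=
    ((integrable_const a).sub hν).abs.comp_snd _
  refine hdom.mono' (by fun_prop) ?_
  have hmem : ∀ᵐ z ∂((volume.restrict (uIoc (0 : ℝ) 1)).prod ν), z.1 ∈ uIoc (0 : ℝ) 1 :=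
    Measure.quasiMeasurePreserving_fst.ae (ae_restrict_mem measurableSet_uIoc)
  filter_upwards [hmem] with z hz
  rw [uIoc_of_le zero_le_one] at hz
  simp only [Function.uncurry, norm_mul]
  rw [Real.norm_of_nonneg (sub_nonneg.2 hz.2)]
  exact (mul_le_of_le_one_left (norm_nonneg _) (by linarith [hz.1])).trans
    (abs_sin_mul_div_le_abs _ _)

lemma integral_fejerKernel_mul_cdf_eq {ν : Measure ℝ} [IsProbabilityMeasure ν]
    (hν : Integrable id ν) (a : ℝ) :
    ∫ v, fejerKernel v * cdf ν (a - v) = (∫ v in Iic 0, fejerKernel v) +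
      ∫ t in (0 : ℝ)..1, ∫ x, (1 - t) * (Real.sin (t * (a - x)) / t) ∂ν := by
  have hsplit (x : ℝ) : ∫ v in Iic (a - x), fejerKernel v = (∫ v in Iic 0, fejerKernel v) +
      ∫ t in (0 : ℝ)..1, (1 - t) * (Real.sin (t * (a - x)) / t) := by
    rw [← intervalIntegral_fejerKernel, ← intervalIntegral.integral_Iic_sub_Iic
      integrable_fejerKernel.integrableOn integrable_fejerKernel.integrableOn]
    ring
  have hint := integrable_prod_sin_mul_div hν a
  rw [integral_fejerKernel_mul_cdf]
  simp only [hsplit]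
  rw [integral_add (integrable_const _) ?_, integral_const, probReal_univ, one_smul,
    intervalIntegral_integral_swap hint]
  simpa only [intervalIntegral.integral_of_le zero_le_one, uIoc_of_le zero_le_one,
    Function.uncurry_apply_pair] using hint.integral_prod_right

lemma integral_sin_mul_sub (ν : Measure ℝ) [IsProbabilityMeasure ν] (t a : ℝ) :
    ∫ x, Real.sin (t * (a - x)) ∂ν =
      -(Complex.exp (-(t * a : ℝ) * Complex.I) * charFun ν t).im := by
  have hint : Integrable (fun x : ℝ => Complex.exp ((t * (x - a) : ℝ) * Complex.I)) ν :=
    (integrable_const (1 : ℝ)).mono' (by fun_prop) (ae_of_all _ fun x => by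
      rw [Complex.norm_exp_ofReal_mul_I])
  have him (x : ℝ) : Real.sin (t * (a - x)) =
      -RCLike.im (Complex.exp ((t * (x - a) : ℝ) * Complex.I)) := by
    rw [RCLike.im_eq_complex_im, Complex.exp_ofReal_mul_I_im, ← Real.sin_neg]
    ring_nf
  simp only [him]
  rw [integral_neg, integral_im hint, RCLike.im_eq_complex_im, charFun_apply_real,
    ← integral_const_mul]
  congr 3 with x
  rw [← Complex.exp_add]
  push_cast
  ring_nf

lemma abs_integral_sin_sub_integral_sin_le (ν γ : Measure ℝ) [IsProbabilityMeasure ν]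
    [IsProbabilityMeasure γ] (t a : ℝ) :
    |∫ x, Real.sin (t * (a - x)) ∂ν - ∫ x, Real.sin (t * (a - x)) ∂γ| ≤
      ‖charFun ν t - charFun γ t‖ := by
  rw [integral_sin_mul_sub, integral_sin_mul_sub, ← neg_sub', abs_neg, ← Complex.sub_im, ← mul_sub]
  refine (Complex.abs_im_le_norm _).trans_eq ?_
  rw [norm_mul, ← Complex.ofReal_neg, Complex.norm_exp_ofReal_mul_I, one_mul]

lemma norm_charFun_sub_one_le {ν : Measure ℝ} [IsProbabilityMeasure ν] (hν : Integrable id ν)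
    (t : ℝ) : ‖charFun ν t - 1‖ ≤ |t| * ∫ x, |x| ∂ν := by
  have hint : Integrable (fun x : ℝ => Complex.exp (t * x * Complex.I)) ν :=
    (integrable_const (1 : ℝ)).mono' (by fun_prop) (ae_of_all _ fun x => by
      rw [← Complex.ofReal_mul, Complex.norm_exp_ofReal_mul_I])
  have hsub : charFun ν t - 1 = ∫ x, (Complex.exp (t * x * Complex.I) - 1) ∂ν := by
    rw [charFun_apply_real, integral_sub hint (integrable_const _)]
    simp
  rw [hsub, ← integral_const_mul]
  refine norm_integral_le_of_norm_le (hν.abs.const_mul _) (ae_of_all _ fun x => ?_)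
  have := Real.norm_exp_I_mul_ofReal_sub_one_le (x := t * x)
  rwa [mul_comm, Complex.ofReal_mul, Real.norm_eq_abs, abs_mul] at this

lemma intervalIntegrable_norm_charFun_sub_div {ν γ : Measure ℝ} [IsProbabilityMeasure ν]
    [IsProbabilityMeasure γ] (hν : Integrable id ν) (hγ : Integrable id γ) (b c : ℝ) :
    IntervalIntegrable (fun t => ‖charFun ν t - charFun γ t‖ / t) volume b c := by
  refine (intervalIntegrable_const (c := (∫ x, |x| ∂ν) + ∫ x, |x| ∂γ)).mono_fun
    (((continuous_charFun.measurable.sub continuous_charFun.measurable).norm.div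
      measurable_id).aestronglyMeasurable) (ae_of_all _ fun t => ?_)
  simp only [norm_div, norm_norm]
  rw [Real.norm_of_nonneg (by positivity : 0 ≤ (∫ x, |x| ∂ν) + ∫ x, |x| ∂γ)]
  refine div_le_of_le_mul₀ (norm_nonneg _) (by positivity) ?_
  calc ‖charFun ν t - charFun γ t‖ = ‖(charFun ν t - 1) - (charFun γ t - 1)‖ := by
        rw [sub_sub_sub_cancel_right]
    _ ≤ |t| * (∫ x, |x| ∂ν) + |t| * ∫ x, |x| ∂γ := (norm_sub_le _ _).trans
        (add_le_add (norm_charFun_sub_one_le hν t) (norm_charFun_sub_one_le hγ t))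
    _ = _ := by rw [Real.norm_eq_abs]; ring

lemma measurable_cdf (ν : Measure ℝ) : Measurable (cdf ν) := (monotone_cdf ν).measurable

lemma abs_cdf_sub_cdf_le_one (ν γ : Measure ℝ) (x : ℝ) : |cdf ν x - cdf γ x| ≤ 1 :=
  abs_sub_le_of_nonneg_of_le (cdf_nonneg ν x) (cdf_le_one ν x) (cdf_nonneg γ x) (cdf_le_one γ x)

lemma abs_integral_fejerKernel_mul_cdf_sub_le {ν γ : Measure ℝ} [IsProbabilityMeasure ν]
    [IsProbabilityMeasure γ] (hν : Integrable id ν) (hγ : Integrable id γ) (a : ℝ) :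
    |∫ v, fejerKernel v * (cdf ν (a - v) - cdf γ (a - v))| ≤
      ∫ t in (0 : ℝ)..1, ‖charFun ν t - charFun γ t‖ / t := by
  have hk (μ : Measure ℝ) : Integrable fun v => fejerKernel v * cdf μ (a - v) :=
    integrable_fejerKernel_mul_comp_sub (measurable_cdf μ)
      (fun x => (abs_of_nonneg (cdf_nonneg μ x)).trans_le (cdf_le_one μ x)) a
  have hI {μ : Measure ℝ} [IsProbabilityMeasure μ] (hμ : Integrable id μ) : IntervalIntegrable
      (fun t => ∫ x, (1 - t) * (Real.sin (t * (a - x)) / t) ∂μ) volume 0 1 :=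
    intervalIntegrable_iff.2 (integrable_prod_sin_mul_div hμ a).integral_prod_left
  simp only [mul_sub]
  rw [integral_sub (hk ν) (hk γ), integral_fejerKernel_mul_cdf_eq hν,
    integral_fejerKernel_mul_cdf_eq hγ, add_sub_add_left_eq_sub,
    ← intervalIntegral.integral_sub (hI hν) (hI hγ), ← Real.norm_eq_abs]
  refine intervalIntegral.norm_integral_le_of_norm_le zero_le_one (ae_of_all _ fun t ht => ?_)
    (intervalIntegrable_norm_charFun_sub_div hν hγ 0 1)
  rw [integral_const_mul, integral_const_mul, integral_div, integral_div, ← mul_sub, ← sub_div,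
    norm_mul, norm_div, Real.norm_of_nonneg (sub_nonneg.2 ht.2), Real.norm_of_nonneg ht.1.le]
  exact (mul_le_of_le_one_left (div_nonneg (norm_nonneg _) ht.1.le) (by linarith [ht.1])).trans
    (div_le_div_of_nonneg_right (abs_integral_sin_sub_integral_sin_le ν γ t a) ht.1.le)

lemma kolmogorovDist_eq_iSup_cdf (ν γ : Measure ℝ) [IsProbabilityMeasure ν]
    [IsProbabilityMeasure γ] : kolmogorovDist ν γ = ⨆ t, |cdf ν t - cdf γ t| := by
  simp only [kolmogorovDist, cdf_eq_real]

lemma bddAbove_range_abs_cdf_sub (ν γ : Measure ℝ) :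
    BddAbove (range fun t => |cdf ν t - cdf γ t|) :=
  ⟨1, forall_mem_range.2 (abs_cdf_sub_cdf_le_one ν γ)⟩

lemma kolmogorovDist_le_one (ν γ : Measure ℝ) [IsProbabilityMeasure ν] [IsProbabilityMeasure γ] :
    kolmogorovDist ν γ ≤ 1 := by
  rw [kolmogorovDist_eq_iSup_cdf]
  exact ciSup_le (abs_cdf_sub_cdf_le_one ν γ)

lemma kolmogorovDist_map_mul (ν γ : Measure ℝ) {T : ℝ} (hT : 0 < T) :
    kolmogorovDist (ν.map (T * ·)) (γ.map (T * ·)) = kolmogorovDist ν γ := by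
  have hpre (x : ℝ) : (T * ·) ⁻¹' Iic (T * x) = Iic x := by
    ext y
    rw [mem_preimage, mem_Iic, mem_Iic, mul_le_mul_iff_right₀ hT]
  have hmap (μ : Measure ℝ) (x : ℝ) : (μ.map (T * ·)).real (Iic (T * x)) = μ.real (Iic x) := by
    rw [map_measureReal_apply (measurable_const_mul T) measurableSet_Iic, hpre]
  rw [kolmogorovDist, kolmogorovDist, ← (Homeomorph.mulLeft₀ T hT.ne').surjective.iSup_comp]
  simp only [Homeomorph.coe_mulLeft₀, hmap]

-- Averaging over a window of length `64` to the right of `x` (to the left, for the lower bound)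
-- loses only the oscillation of `cdf γ`, because `cdf ν` is monotone; the kernel mass outside the
-- window costs a quarter of the distance itself, which is absorbed.
lemma kolmogorovDist_le_of_lipschitzWith_cdf {ν γ : Measure ℝ} [IsProbabilityMeasure ν]
    [IsProbabilityMeasure γ] (hν : Integrable id ν) (hγ : Integrable id γ) {m : ℝ≥0}
    (hm : LipschitzWith m (cdf γ)) :
    kolmogorovDist ν γ ≤
      86 * m + 3 * ∫ t in (0 : ℝ)..1, ‖charFun ν t - charFun γ t‖ / t := by
  rw [kolmogorovDist_eq_iSup_cdf]
  set J := ∫ t in (0 : ℝ)..1, ‖charFun ν t - charFun γ t‖ / t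
  set η := ⨆ t, |cdf ν t - cdf γ t|
  have hη (x : ℝ) : |cdf ν x - cdf γ x| ≤ η := le_ciSup (bddAbove_range_abs_cdf_sub ν γ) x
  have hD : Measurable fun x => cdf ν x - cdf γ x := (measurable_cdf ν).sub (measurable_cdf γ)
  have hJ := abs_integral_fejerKernel_mul_cdf_sub_le hν hγ
  have hosc {x y : ℝ} (hxy : |x - y| ≤ 64) : |cdf γ x - cdf γ y| ≤ m * 64 :=
    (hm.dist_le_mul x y).trans (mul_le_mul_of_nonneg_left hxy m.2)
  have hJ0 : 0 ≤ J := (abs_nonneg _).trans (hJ 0)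
  suffices ∀ x, |cdf ν x - cdf γ x| ≤ 64 * m + 2 * J + 8 / 32 * η by
    linarith [ciSup_le this, m.2]
  intro x
  refine abs_le'.2 ⟨?_, ?_⟩
  · have := le_abs_integral_fejerKernel_mul_add (d := cdf ν x - cdf γ x - m * 64) (a := x + 32)
      (h := 32) hD hη (by norm_num) fun v hv => by
        have hγv := hosc (x := x + 32 - v) (y := x)
          (abs_le.2 (by constructor <;> linarith [hv.1, hv.2]))
        linarith [monotone_cdf ν (show x ≤ x + 32 - v by linarith [hv.2]), le_of_abs_le hγv]
    linarith [hJ (x + 32)]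
  · have := le_abs_integral_fejerKernel_mul_add (d := cdf γ x - cdf ν x - m * 64) (a := x - 32)
      (h := 32) hD.neg (fun y => (abs_neg _).trans_le (hη y)) (by norm_num) fun v hv => by
        have hγv := hosc (x := x) (y := x - 32 - v)
          (abs_le.2 (by constructor <;> linarith [hv.1, hv.2]))
        have := monotone_cdf ν (show x - 32 - v ≤ x by linarith [hv.1])
        simp only [Pi.neg_apply]
        linarith [le_of_abs_le hγv]
    simp only [Pi.neg_apply, mul_neg, integral_neg, abs_neg] at this
    linarith [hJ (x - 32)]

lemma lipschitzWith_cdf_map_mul {γ : Measure ℝ} [IsProbabilityMeasure γ] {m T : ℝ≥0} (hT : 0 < T)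
    (hm : LipschitzWith m (cdf γ)) : LipschitzWith (T⁻¹ * m) (cdf (γ.map ((T : ℝ) * ·))) := by
  have hT' : (0 : ℝ) < T := hT
  have : IsProbabilityMeasure (γ.map ((T : ℝ) * ·)) :=
    Measure.isProbabilityMeasure_map (measurable_const_mul _).aemeasurable
  have hcdf (x : ℝ) : cdf (γ.map ((T : ℝ) * ·)) x = cdf γ ((T : ℝ)⁻¹ * x) := by
    rw [cdf_eq_real, cdf_eq_real, map_measureReal_apply (measurable_const_mul _) measurableSet_Iic]
    congr with y
    rw [mem_preimage, mem_Iic, mem_Iic, le_inv_mul_iff₀ hT']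
  refine LipschitzWith.of_dist_le_mul fun x y => ?_
  rw [hcdf, hcdf]
  refine (hm.dist_le_mul _ _).trans_eq ?_
  rw [Real.dist_eq, Real.dist_eq, ← mul_sub, abs_mul, abs_of_pos (inv_pos.2 hT')]
  push_cast
  ring

lemma kolmogorovDist_le_add_integral {ν γ : Measure ℝ} [IsProbabilityMeasure ν]
    [IsProbabilityMeasure γ] (hν : Integrable id ν) (hγ : Integrable id γ) {m : ℝ≥0} {T : ℝ}
    (hm : LipschitzWith m (cdf γ)) (hT : 0 < T) :
    kolmogorovDist ν γ ≤
      86 * m / T + 3 * ∫ t in (0 : ℝ)..T, ‖charFun ν t - charFun γ t‖ / t := by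
  lift T to ℝ≥0 using hT.le
  have hTmeas : Measurable ((T : ℝ) * ·) := measurable_const_mul _
  have hprob (μ : Measure ℝ) [IsProbabilityMeasure μ] :
      IsProbabilityMeasure (μ.map ((T : ℝ) * ·)) :=
    Measure.isProbabilityMeasure_map hTmeas.aemeasurable
  have := hprob ν
  have := hprob γ
  have hid {μ : Measure ℝ} (hμ : Integrable id μ) :
      Integrable id (μ.map ((T : ℝ) * ·)) :=
    (integrable_map_measure aestronglyMeasurable_id hTmeas.aemeasurable).2 (hμ.const_mul T)
  have hsub : ∫ t in (0 : ℝ)..1, ‖charFun ν (T * t) - charFun γ (T * t)‖ / t =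
      ∫ t in (0 : ℝ)..T, ‖charFun ν t - charFun γ t‖ / t := by
    have := intervalIntegral.mul_integral_comp_mul_left (a := 0) (b := 1) (T : ℝ)
      (f := fun t => ‖charFun ν t - charFun γ t‖ / t)
    rw [mul_zero, mul_one] at this
    rw [← this, ← intervalIntegral.integral_const_mul]
    congr with t
    rw [← mul_div_assoc, mul_div_mul_left _ _ hT.ne']
  have := kolmogorovDist_le_of_lipschitzWith_cdf (hid hν) (hid hγ) (lipschitzWith_cdf_map_mul hT hm)
  simp only [charFun_map_mul, hsub, kolmogorovDist_map_mul ν γ hT] at this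
  refine this.trans_eq ?_
  push_cast
  ring

lemma gaussianPDFReal_le (μ : ℝ) (v : ℝ≥0) (x : ℝ) :
    gaussianPDFReal μ v x ≤ (√(2 * Real.pi * v))⁻¹ := by
  rw [gaussianPDFReal]
  refine mul_le_of_le_one_right (by positivity) (Real.exp_le_one_iff.2 ?_)
  rw [neg_div]
  exact neg_nonpos.2 (by positivity)

lemma lipschitzWith_cdf_gaussianReal (μ : ℝ) {v : ℝ≥0} (hv : v ≠ 0) :
    LipschitzWith (√(2 * Real.pi * v))⁻¹.toNNReal (cdf (gaussianReal μ v)) := by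
  refine LipschitzWith.of_le_add_mul _ fun x y => ?_
  rw [Real.coe_toNNReal _ (by positivity)]
  rcases le_total x y with hxy | hyx
  · exact (monotone_cdf _ hxy).trans (le_add_of_nonneg_right (by positivity))
  suffices (gaussianReal μ v).real (Ioc y x) ≤ (√(2 * Real.pi * v))⁻¹ * dist x y by
    rw [← Iic_sdiff_Iic, measureReal_sdiff (Iic_subset_Iic.2 hyx) measurableSet_Iic,
      ← cdf_eq_real, ← cdf_eq_real] at this
    linarith
  rw [measureReal_def, gaussianReal_apply_eq_integral _ hv,
    ENNReal.toReal_ofReal (integral_nonneg fun z => gaussianPDFReal_nonneg _ _ _)]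
  calc ∫ z in Ioc y x, gaussianPDFReal μ v z ≤ ∫ z in Ioc y x, (√(2 * Real.pi * v))⁻¹ :=
        setIntegral_mono (integrable_gaussianPDFReal _ _).integrableOn
          (integrableOn_const measure_Ioc_lt_top.ne)
          (gaussianPDFReal_le μ v)
    _ = (√(2 * Real.pi * v))⁻¹ * dist x y := by
        rw [setIntegral_const, Real.volume_real_Ioc_of_le hyx, smul_eq_mul, mul_comm,
          Real.dist_eq, abs_of_nonneg (sub_nonneg.2 hyx)]

lemma lipschitzWith_one_cdf_gaussianReal : LipschitzWith 1 (cdf (gaussianReal 0 1)) := by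
  refine (lipschitzWith_cdf_gaussianReal 0 one_ne_zero).weaken ?_
  rw [Real.toNNReal_le_one]
  refine inv_le_one_of_one_le₀ (Real.one_le_sqrt.2 ?_)
  rw [NNReal.coe_one]
  linarith [Real.pi_gt_three]

lemma integral_sq_mul_exp_neg_sq_le {T : ℝ} (hT : 0 ≤ T) :
    ∫ t in (0 : ℝ)..T, t ^ 2 * Real.exp (-(t ^ 2 / 4)) ≤ 24 := by
  have hpt (t : ℝ) : t ^ 2 * Real.exp (-(t ^ 2 / 4)) ≤ 8 * Real.exp (-(1 / 8) * t ^ 2) := by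
    have hexp : Real.exp (-(1 / 8) * t ^ 2) =
        Real.exp (t ^ 2 / 8) * Real.exp (-(t ^ 2 / 4)) := by
      rw [← Real.exp_add]
      ring_nf
    rw [hexp, ← mul_assoc]
    exact mul_le_mul_of_nonneg_right (by linarith [Real.add_one_le_exp (t ^ 2 / 8)])
      (Real.exp_pos _).le
  calc ∫ t in (0 : ℝ)..T, t ^ 2 * Real.exp (-(t ^ 2 / 4))
      ≤ ∫ t in (0 : ℝ)..T, 8 * Real.exp (-(1 / 8) * t ^ 2) :=
        intervalIntegral.integral_mono_on hT (Continuous.intervalIntegrable (by fun_prop) _ _)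
          (Continuous.intervalIntegrable (by fun_prop) _ _) fun t _ => hpt t
    _ ≤ ∫ t in Ioi (0 : ℝ), 8 * Real.exp (-(1 / 8) * t ^ 2) := by
        rw [intervalIntegral.integral_of_le hT]
        exact setIntegral_mono_set
          ((integrable_exp_neg_mul_sq (by norm_num)).const_mul 8).integrableOn
          (ae_of_all _ fun t => by positivity) Ioc_subset_Ioi_self.eventuallyLE
    _ = 8 * (√(Real.pi / (1 / 8)) / 2) := by rw [integral_const_mul, integral_gaussian_Ioi]
    _ ≤ 24 := by
        have : √(Real.pi / (1 / 8)) ≤ 6 :=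
          (Real.sqrt_le_left (by norm_num)).2 (by linarith [Real.pi_le_four])
        linarith

lemma kolmogorovDist_gaussianReal_le_div {ν : Measure ℝ} [IsProbabilityMeasure ν]
    (hν : Integrable id ν) {T : ℝ} (hT : 0 < T)
    (h : ∀ t ∈ Ioc 0 T, ‖charFun ν t - charFun (gaussianReal 0 1) t‖ ≤
      t ^ 3 / (4 * T) * Real.exp (-(t ^ 2 / 4))) :
    kolmogorovDist ν (gaussianReal 0 1) ≤ 104 / T := by
  have hγ : Integrable id (gaussianReal 0 1) := memLp_one_iff_integrable.1 (memLp_id_gaussianReal 1)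
  have hJ : ∫ t in (0 : ℝ)..T, ‖charFun ν t - charFun (gaussianReal 0 1) t‖ / t ≤ 6 / T := by
    calc _ ≤ ∫ t in (0 : ℝ)..T, 1 / (4 * T) * (t ^ 2 * Real.exp (-(t ^ 2 / 4))) := by
          refine intervalIntegral.integral_mono_on_of_le_Ioo hT.le
            (intervalIntegrable_norm_charFun_sub_div hν hγ 0 T)
            (Continuous.intervalIntegrable (by fun_prop) _ _) fun t ht => ?_
          rw [div_le_iff₀ ht.1]
          exact (h t ⟨ht.1, ht.2.le⟩).trans_eq (by ring)
      _ ≤ 1 / (4 * T) * 24 := by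
          rw [intervalIntegral.integral_const_mul]
          exact mul_le_mul_of_nonneg_left (integral_sq_mul_exp_neg_sq_le hT.le) (by positivity)
      _ = 6 / T := by ring
  calc kolmogorovDist ν (gaussianReal 0 1) ≤ 86 * (1 : ℝ≥0) / T +
        3 * ∫ t in (0 : ℝ)..T, ‖charFun ν t - charFun (gaussianReal 0 1) t‖ / t :=
        kolmogorovDist_le_add_integral hν hγ lipschitzWith_one_cdf_gaussianReal hT
    _ ≤ 86 / T + 3 * (6 / T) := by rw [NNReal.coe_one, mul_one]; gcongr
    _ = 104 / T := by ring

end Smoothing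

section TypicallyReal

open Complex Metric Set
open scoped ComplexConjugate

lemma le_re_of_forall_mem_frontier_le_re {f : ℂ → ℂ} {U : Set ℂ} (hU : Bornology.IsBounded U)
    (hd : DiffContOnCl ℂ f U) {c : ℝ} (hc : ∀ z ∈ frontier U, c ≤ (f z).re) {z : ℂ}
    (hz : z ∈ closure U) : c ≤ (f z).re := by
  have h := norm_le_of_forall_mem_frontier_norm_le (f := fun z => exp (-f z)) (C := Real.exp (-c))
    hU ⟨hd.1.neg.cexp, hd.2.neg.cexp⟩ (fun w hw => by
      rw [norm_exp, neg_re]; exact Real.exp_le_exp.2 (neg_le_neg (hc w hw))) hz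
  rw [norm_exp, neg_re, Real.exp_le_exp] at h
  linarith

lemma norm_sub_apply_zero_le_of_neg_le_re {f : ℂ → ℂ} {r c : ℝ} {w : ℂ}
    (hf : DiffContOnCl ℂ f (ball 0 r)) (hc : ∀ z ∈ sphere (0 : ℂ) r, -c ≤ (f z).re)
    (h0 : 0 < (f 0).re + c) (hw : ‖w‖ < r) :
    ‖f w - f 0‖ ≤ 2 * ((f 0).re + c) * ‖w‖ / (r - ‖w‖) := by
  have hr : 0 < r := (norm_nonneg w).trans_lt hw
  rw [norm_sub_rev]
  refine borelCaratheodory_zero (f := fun z => f 0 - f z) h0 (hf.1.const_sub _) (fun z hz => ?_)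
    hr (mem_ball_zero_iff.2 hw) (sub_self _)
  have := le_re_of_forall_mem_frontier_le_re isBounded_ball hf
    (fun u hu => hc u (frontier_ball (0 : ℂ) hr.ne' ▸ hu)) (subset_closure hz)
  simp only [mem_ofPred_eq, sub_re]
  linarith

-- Rogosinski's device: on the circle `1 - (z / r) ^ 2 = z (conj z - z) / r ^ 2`, which turns the
-- imaginary part of `g` into the real part of a holomorphic function.
lemma re_dslope_zero_mul_one_sub_sq {g : ℂ → ℂ} {z : ℂ} (hz : z ≠ 0) (hg0 : (g 0).im = 0) :
    (dslope g 0 z * (1 - (z / ‖z‖) ^ 2)).re = 2 * z.im * (g z).im / ‖z‖ ^ 2 := by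
  have hnorm : (‖z‖ : ℂ) ≠ 0 := ofReal_ne_zero.2 (norm_ne_zero_iff.2 hz)
  have hmul : dslope g 0 z * (1 - (z / ‖z‖) ^ 2) =
      (g z - g 0) * (conj z - z) / (‖z‖ ^ 2 : ℝ) := by
    rw [dslope_of_ne _ hz, slope_def_field, sub_zero, ofReal_pow]
    field_simp
    rw [← mul_conj']
    ring
  rw [hmul, div_ofReal_re]
  congr 1
  simp only [mul_re, sub_re, sub_im, conj_re, conj_im, hg0]
  ring

lemma neg_le_im_mul_im_of_symm {g : ℂ → ℂ} {r ε : ℝ}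
    (hsymm : ∀ z : ℂ, ‖z‖ = r → g (conj z) = conj (g z))
    (him : ∀ z : ℂ, ‖z‖ = r → 0 ≤ z.im → -ε ≤ (g z).im) (hε : 0 ≤ ε) {z : ℂ} (hz : ‖z‖ = r) :
    -(r * ε) ≤ z.im * (g z).im := by
  wlog hi : 0 ≤ z.im generalizing z
  · have := this (z := conj z) (by rwa [norm_conj]) (by rw [conj_im]; linarith)
    rwa [hsymm z hz, conj_im, conj_im, neg_mul_neg] at this
  · have hzr : z.im ≤ r := (le_abs_self _).trans (hz ▸ abs_im_le_norm z)
    calc -(r * ε) ≤ -(z.im * ε) := neg_le_neg (mul_le_mul_of_nonneg_right hzr hε)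
      _ = z.im * -ε := (mul_neg _ _).symm
      _ ≤ _ := mul_le_mul_of_nonneg_left (him z hz hi) hi

lemma norm_dslope_mul_one_sub_sq_sub_le {g : ℂ → ℂ} {r s ε d : ℝ} (hr : 0 < r) (hrs : r < s)
    (hg : DifferentiableOn ℂ g (ball 0 s)) (hg0 : (g 0).im = 0)
    (hsymm : ∀ z : ℂ, ‖z‖ = r → g (conj z) = conj (g z))
    (him : ∀ z : ℂ, ‖z‖ = r → 0 ≤ z.im → -ε ≤ (g z).im) (hε : 0 ≤ ε) (hd : 0 < d)
    (hdg : deriv g 0 = d) {w : ℂ} (hw : ‖w‖ < r) :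
    ‖dslope g 0 w * (1 - (w / r) ^ 2) - d‖ ≤ 2 * (d + 2 * ε / r) * ‖w‖ / (r - ‖w‖) := by
  set f : ℂ → ℂ := fun z => dslope g 0 z * (1 - (z / r) ^ 2)
  have hf0 : f 0 = d := by simp [f, dslope_same, hdg]
  have hball : ball (0 : ℂ) s ∈ nhds 0 := ball_mem_nhds 0 (hr.trans hrs)
  have hf : DifferentiableOn ℂ f (ball 0 s) :=
    ((differentiableOn_dslope hball).2 hg).mul (by fun_prop)
  have hcl : closure (ball (0 : ℂ) r) ⊆ ball 0 s :=
    closure_ball_subset_closedBall.trans (closedBall_subset_ball hrs)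
  have hre (z : ℂ) (hz : z ∈ sphere (0 : ℂ) r) : -(2 * ε / r) ≤ (f z).re := by
    rw [mem_sphere_zero_iff_norm] at hz
    have hz0 : z ≠ 0 := norm_pos_iff.1 (hz.symm ▸ hr)
    have := re_dslope_zero_mul_one_sub_sq hz0 hg0
    rw [hz] at this
    rw [this, le_div_iff₀ (by positivity)]
    have hcancel : -(2 * ε / r) * r ^ 2 = 2 * -(r * ε) := by field_simp
    linarith [neg_le_im_mul_im_of_symm hsymm him hε hz]
  have := norm_sub_apply_zero_le_of_neg_le_re (hf.mono hcl).diffContOnCl hre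
    (by rw [hf0, ofReal_re]; positivity) hw
  rwa [hf0, ofReal_re] at this

lemma norm_sub_sub_mul_le_of_neg_le_im {g : ℂ → ℂ} {r s ε d : ℝ} (hr : 0 < r) (hrs : r < s)
    (hg : DifferentiableOn ℂ g (ball 0 s)) (hg0 : (g 0).im = 0)
    (hsymm : ∀ z : ℂ, ‖z‖ = r → g (conj z) = conj (g z))
    (him : ∀ z : ℂ, ‖z‖ = r → 0 ≤ z.im → -ε ≤ (g z).im) (hε : 0 ≤ ε) (hd : 0 < d)
    (hdg : deriv g 0 = d) {w : ℂ} (hw : ‖w‖ ≤ r / 2) :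
    ‖g w - g 0 - d * w‖ ≤ 6 * (d + 2 * ε / r) * ‖w‖ ^ 2 / r := by
  set M := d + 2 * ε / r
  have hM : 0 ≤ M := by positivity
  have hdM : d ≤ M := le_add_of_nonneg_right (by positivity)
  set q : ℂ := (w / r) ^ 2
  have hx : ‖w‖ / r ≤ 1 / 2 := by rw [div_le_iff₀ hr]; linarith
  have hq : ‖q‖ = (‖w‖ / r) ^ 2 := by
    rw [norm_pow, norm_div, norm_real, Real.norm_of_nonneg hr.le]
  have hq' : ‖q‖ ≤ ‖w‖ / r / 2 := by
    rw [hq, sq]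
    exact (mul_le_mul_of_nonneg_left hx (by positivity)).trans_eq (by ring)
  have hfw : ‖dslope g 0 w * (1 - q) - d‖ ≤ 4 * M * (‖w‖ / r) := by
    refine (norm_dslope_mul_one_sub_sq_sub_le hr hrs hg hg0 hsymm him hε hd hdg
      (by linarith)).trans ?_
    rw [div_le_iff₀ (by linarith)]
    calc 2 * M * ‖w‖ = 4 * M * (‖w‖ / r) * (r / 2) := by field_simp; ring
      _ ≤ _ := mul_le_mul_of_nonneg_left (by linarith) (by positivity)
  have hden : 3 / 4 ≤ ‖1 - q‖ := by
    have := norm_sub_norm_le (1 : ℂ) q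
    rw [norm_one] at this
    linarith
  have hfactor : (g w - g 0 - d * w) * (1 - q) =
      w * ((dslope g 0 w * (1 - q) - d) + d * q) := by
    have := sub_smul_dslope g 0 w
    rw [sub_zero, smul_eq_mul] at this
    rw [← this]
    ring
  have hmain : ‖g w - g 0 - d * w‖ * (3 / 4) ≤ 6 * M * ‖w‖ ^ 2 / r * (3 / 4) := by
    calc ‖g w - g 0 - d * w‖ * (3 / 4) ≤ ‖g w - g 0 - d * w‖ * ‖1 - q‖ :=
          mul_le_mul_of_nonneg_left hden (norm_nonneg _)
      _ = ‖w‖ * ‖(dslope g 0 w * (1 - q) - d) + d * q‖ := by rw [← norm_mul, hfactor, norm_mul]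
      _ ≤ ‖w‖ * (4 * M * (‖w‖ / r) + M * (‖w‖ / r / 2)) := by
          refine mul_le_mul_of_nonneg_left (norm_add_le_of_le hfw ?_) (norm_nonneg _)
          rw [norm_mul, norm_real, Real.norm_of_nonneg hd.le]
          exact mul_le_mul hdM hq' (norm_nonneg _) hM
      _ = _ := by ring
  linarith

end TypicallyReal

section Reflection

open Complex Metric Set
open scoped ComplexConjugate

lemma deriv_nonpos_of_nonneg_of_eq_zero {q : ℝ → ℝ} {q' b : ℝ} (hb : 0 < b)
    (hq : HasDerivAt q q' b) (h0 : q b = 0) (hnn : ∀ y ∈ Ioo 0 b, 0 ≤ q y) : q' ≤ 0 := by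
  refine le_of_tendsto (hasDerivAt_iff_tendsto_slope_left_right.1 hq).1 ?_
  filter_upwards [Ioo_mem_nhdsLT hb] with y hy
  rw [slope_def_field, h0, sub_zero]
  exact div_nonpos_of_nonneg_of_nonpos (hnn y hy) (by linarith [hy.2])

lemma re_cosh (z : ℂ) : (cosh z).re = Real.cosh z.re * Real.cos z.im := by
  conv_lhs => rw [← re_add_im z, cosh_add, cosh_mul_I, sinh_mul_I]
  simp [← ofReal_cosh, ← ofReal_sinh, ← ofReal_cos, ← ofReal_sin]

lemma cosh_div_cosh_le {x a : ℝ} (hx : |x| ≤ a / 2) :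
    Real.cosh x / Real.cosh a ≤ 2 * Real.exp (-(a / 2)) := by
  rw [div_le_iff₀ (Real.cosh_pos a)]
  have hcx : Real.cosh x ≤ Real.exp (a / 2) := by
    have h1 := Real.exp_le_exp.2 ((le_abs_self x).trans hx)
    have h2 := Real.exp_le_exp.2 ((neg_le_abs x).trans hx)
    rw [Real.cosh_eq]
    linarith
  have hexp : Real.exp (-(a / 2)) * Real.exp a = Real.exp (a / 2) := by
    rw [← Real.exp_add]
    ring_nf
  calc Real.cosh x ≤ Real.exp (-(a / 2)) * Real.exp a := hcx.trans_eq hexp.symm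
    _ ≤ Real.exp (-(a / 2)) * (2 * Real.cosh a) := by
      refine mul_le_mul_of_nonneg_left ?_ (Real.exp_pos _).le
      rw [Real.cosh_eq]
      linarith [Real.exp_pos (-a)]
    _ = _ := by ring

lemma one_sub_div_le_cos {b y : ℝ} (hb : 0 < b) (hy : y ∈ Icc 0 b) :
    1 - y / b ≤ Real.cos (Real.pi / (2 * b) * y) := by
  have hκ : 0 < Real.pi / (2 * b) := div_pos Real.pi_pos (by positivity)
  have hκb : Real.pi / (2 * b) * b = Real.pi / 2 := by field_simp
  have := Real.one_sub_mul_le_cos (mul_nonneg hκ.le hy.1)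
    (hκb ▸ mul_le_mul_of_nonneg_left hy.2 hκ.le)
  have hmul : 2 / Real.pi * (Real.pi / (2 * b) * y) = y / b := by field_simp
  rwa [hmul] at this

lemma mem_frontier_reProdIm_Ioo {a b : ℝ} (ha : 0 < a) (hb : 0 < b) {z : ℂ}
    (hz : z ∈ frontier (Ioo (-a) a ×ℂ Ioo 0 b)) :
    |z.re| ≤ a ∧ z.im ∈ Icc 0 b ∧ (|z.re| = a ∨ z.im = 0 ∨ z.im = b) := by
  have hna : -a < a := by linarith
  rw [frontier_reProdIm, frontier_Ioo hna, frontier_Ioo hb, closure_Ioo hna.ne,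
    closure_Ioo hb.ne] at hz
  rcases hz with ⟨hre, him⟩ | ⟨hre, him⟩
  · refine ⟨abs_le.2 hre, ?_, Or.inr him⟩
    rcases him with h | h <;> rw [h] <;> simp [hb.le]
  · have : |z.re| = a := by
      rcases hre with h | h <;> rw [h] <;> simp [abs_of_pos ha]
    exact ⟨this.le, him, Or.inl this⟩

-- The barrier is the real part of the holomorphic function `cosh (κ z)`, `κ = π / (2 b)`: it
-- vanishes on the upper side and decays exponentially away from the vertical sides.
lemma neg_mul_cosh_mul_cos_le_re {F : ℂ → ℂ} {a b M : ℝ} (ha : 0 < a) (hb : 0 < b) (hM : 0 ≤ M)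
    (hF : DiffContOnCl ℂ F (Ioo (-a) a ×ℂ Ioo 0 b))
    (hhor : ∀ z : ℂ, |z.re| ≤ a → z.im = 0 ∨ z.im = b → 0 ≤ (F z).re)
    (hver : ∀ z : ℂ, |z.re| = a → z.im ∈ Icc 0 b → -(M * (1 - z.im / b)) ≤ (F z).re)
    {z : ℂ} (hzre : |z.re| ≤ a) (hzim : z.im ∈ Icc 0 b) :
    -(M * Real.cosh (Real.pi / (2 * b) * z.re) / Real.cosh (Real.pi / (2 * b) * a) *
      Real.cos (Real.pi / (2 * b) * z.im)) ≤ (F z).re := by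
  set κ : ℝ := Real.pi / (2 * b)
  set C : ℝ := Real.cosh (κ * a)
  have hC : 0 < C := Real.cosh_pos _
  have hκ : 0 < κ := div_pos Real.pi_pos (by positivity)
  set G : ℂ → ℂ := fun z => F z + ((M / C : ℝ) : ℂ) * cosh (κ * z)
  have hGre (z : ℂ) :
      (G z).re = (F z).re + M * Real.cosh (κ * z.re) / C * Real.cos (κ * z.im) := by
    simp only [G, add_re, re_ofReal_mul, re_cosh, im_ofReal_mul]
    ring
  have hfront (w : ℂ) (hw : w ∈ frontier (Ioo (-a) a ×ℂ Ioo 0 b)) : 0 ≤ (G w).re := by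
    obtain ⟨hre, him, hside⟩ := mem_frontier_reProdIm_Ioo ha hb hw
    have hc : 1 - w.im / b ≤ Real.cos (κ * w.im) := one_sub_div_le_cos hb him
    rw [hGre]
    rcases hside with hside | hside
    · have hcosh : Real.cosh (κ * w.re) = C := by
        rw [← Real.cosh_abs, abs_mul, abs_of_pos hκ, hside]
      rw [hcosh, mul_div_cancel_right₀ _ hC.ne']
      linarith [hver w hside him, mul_le_mul_of_nonneg_left hc hM]
    · have hcos : 0 ≤ Real.cos (κ * w.im) :=
        (sub_nonneg.2 (div_le_one_of_le₀ him.2 hb.le)).trans hc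
      exact add_nonneg (hhor w hre hside)
        (mul_nonneg (div_nonneg (mul_nonneg hM (Real.cosh_pos _).le) hC.le) hcos)
  have hcl : z ∈ closure (Ioo (-a) a ×ℂ Ioo 0 b) := by
    rw [closure_reProdIm, closure_Ioo (by linarith : -a ≠ a), closure_Ioo hb.ne]
    exact ⟨abs_le.1 hzre, hzim⟩
  have hcosh : Differentiable ℂ fun z : ℂ => ((M / C : ℝ) : ℂ) * cosh (κ * z) := by fun_prop
  have hG : DiffContOnCl ℂ G (Ioo (-a) a ×ℂ Ioo 0 b) := hF.add hcosh.diffContOnCl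
  have := le_re_of_forall_mem_frontier_le_re
    ((isBounded_Ioo _ _).reProdIm (isBounded_Ioo _ _)) hG hfront hcl
  rw [hGre] at this
  linarith

lemma mem_ball_of_abs_re_le_of_abs_im_le {z : ℂ} {a b ρ : ℝ} (hre : |z.re| ≤ a)
    (him : |z.im| ≤ b) (h : a + b < ρ) : z ∈ ball (0 : ℂ) ρ := by
  rw [mem_ball_zero_iff]
  exact (norm_le_abs_re_add_abs_im z).trans_lt (by linarith)

lemma conj_mem_ball_zero {z : ℂ} {ρ : ℝ} (hz : z ∈ ball (0 : ℂ) ρ) : conj z ∈ ball (0 : ℂ) ρ := by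
  rwa [mem_ball_zero_iff, norm_conj, ← mem_ball_zero_iff]

lemma deriv_conj_of_symm {f : ℂ → ℂ} {s : Set ℂ} (hs : IsOpen s)
    (hf : ∀ z ∈ s, f (conj z) = conj (f z)) {z : ℂ} (hz : z ∈ s) :
    deriv f (conj z) = conj (deriv f z) := by
  have h : conj ∘ f ∘ conj =ᶠ[nhds z] f := by
    filter_upwards [hs.mem_nhds hz] with w hw
    rw [Function.comp_apply, Function.comp_apply, hf w hw, conj_conj]
  rw [← h.deriv_eq, deriv_conj_conj, Function.comp_apply, Function.comp_apply, conj_conj]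

section

variable {φ : ℂ → ℂ} {ρ a b L : ℝ} (ha : 0 < a) (hb : 0 < b) (hab : a + 2 * b < ρ)
  (hφ : DifferentiableOn ℂ φ (ball 0 ρ)) (hL : ∀ z ∈ ball (0 : ℂ) ρ, ‖deriv φ z‖ ≤ L)
  (hconj : ∀ z ∈ ball (0 : ℂ) ρ, φ (conj z) = conj (φ z))
  (hre : ∀ z ∈ ball (0 : ℂ) ρ, (φ z).re ≤ (φ z.re).re)

include hab in
lemma mem_ball_and_sub_mem_ball {z : ℂ} (hzre : |z.re| ≤ a) (hzim : z.im ∈ Icc 0 b) :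
    z ∈ ball (0 : ℂ) ρ ∧ z - 2 * b * I ∈ ball (0 : ℂ) ρ := by
  refine ⟨mem_ball_of_abs_re_le_of_abs_im_le hzre (b := 2 * b) ?_ hab,
    mem_ball_of_abs_re_le_of_abs_im_le (a := a) (b := 2 * b) ?_ ?_ hab⟩
  · rw [abs_of_nonneg hzim.1]
    linarith [hzim.1, hzim.2]
  · simpa using hzre
  · suffices |z.im - 2 * b| ≤ 2 * b by simpa using this
    rw [abs_of_nonpos (by linarith [hzim.1, hzim.2])]
    linarith [hzim.1]

include hφ hL hconj in
lemma re_sub_re_le_of_im_le {z : ℂ} {b : ℝ} (hz : z ∈ ball (0 : ℂ) ρ)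
    (hz' : z - 2 * b * I ∈ ball (0 : ℂ) ρ) (hzb : z.im ≤ b) :
    (φ (z - 2 * b * I)).re - (φ z).re ≤ L * (2 * (b - z.im)) := by
  have hmvt := (convex_ball (0 : ℂ) ρ).norm_image_sub_le_of_norm_deriv_le
    (fun w hw => hφ.differentiableAt (isOpen_ball.mem_nhds hw)) hL hz (conj_mem_ball_zero hz')
  have hdist : conj (z - 2 * b * I) - z = ((2 * (b - z.im) : ℝ) : ℂ) * I := by
    apply Complex.ext <;> simp
    ring
  rw [hdist, norm_mul, norm_I, mul_one, norm_real, Real.norm_of_nonneg (by linarith),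
    hconj _ hz'] at hmvt
  simpa using (re_le_norm _).trans hmvt

-- Along vertical lines `Re φ` is largest on the real axis, which makes it almost
-- decreasing away from it: compare `φ` with its reflection in `Im z = b`, where both agree.
include ha hb hab hφ hL hconj hre in
lemma neg_mul_cosh_mul_cos_le_re_sub {z : ℂ} (hzre : |z.re| ≤ a) (hzim : z.im ∈ Icc 0 b) :
    -(2 * L * b * Real.cosh (Real.pi / (2 * b) * z.re) / Real.cosh (Real.pi / (2 * b) * a) *
      Real.cos (Real.pi / (2 * b) * z.im)) ≤ (φ z).re - (φ (z - 2 * b * I)).re := by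
  have hL0 : 0 ≤ L := (norm_nonneg _).trans (hL 0 (mem_ball_self (by linarith)))
  rw [← sub_re]
  refine neg_mul_cosh_mul_cos_le_re (F := fun z => φ z - φ (z - 2 * b * I)) ha hb (by positivity)
    ?_ (fun w hwre hw => ?_) (fun w hwre hwim => ?_) hzre hzim
  · refine DifferentiableOn.diffContOnCl fun w hw => ?_
    rw [closure_reProdIm, closure_Ioo (by linarith : -a ≠ a), closure_Ioo hb.ne] at hw
    obtain ⟨h1, h2⟩ := mem_ball_and_sub_mem_ball hab (abs_le.2 hw.1) hw.2
    have hd := hφ.differentiableAt (isOpen_ball.mem_nhds h2)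
    exact ((hφ.differentiableAt (isOpen_ball.mem_nhds h1)).sub
      (hd.comp w (by fun_prop : DifferentiableAt ℂ (· - 2 * b * I) w))).differentiableWithinAt
  · have hwim : w.im ∈ Icc 0 b := by rcases hw with h | h <;> rw [h] <;> simp [hb.le]
    obtain ⟨hw1, hw2⟩ := mem_ball_and_sub_mem_ball hab hwre hwim
    rw [sub_re, sub_nonneg]
    rcases hw with hw | hw
    · have hreal : ((w - 2 * b * I).re : ℂ) = w := Complex.ext (by simp) (by simp [hw])
      have := hre _ hw2
      rwa [hreal] at this
    · have hrefl : w - 2 * b * I = conj w := Complex.ext (by simp) (by simp [hw]; ring)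
      rw [hrefl, hconj w hw1, conj_re]
  · obtain ⟨hw1, hw2⟩ := mem_ball_and_sub_mem_ball hab hwre.le hwim
    have := re_sub_re_le_of_im_le hφ hL hconj hw1 hw2 hwim.2
    have hmul : 2 * L * b * (1 - w.im / b) = L * (2 * (b - w.im)) := by field_simp
    rw [hmul, sub_re]
    linarith

include ha hb hab hφ hL hconj hre in
lemma neg_mul_cosh_div_cosh_le_im_deriv {x : ℝ} (hx : |x| ≤ a) :
    -(Real.pi * L / 2 *
      (Real.cosh (Real.pi / (2 * b) * x) / Real.cosh (Real.pi / (2 * b) * a))) ≤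
        (deriv φ (x + b * I)).im := by
  set κ : ℝ := Real.pi / (2 * b) with hκ
  set K : ℝ := 2 * L * b * Real.cosh (κ * x) / Real.cosh (κ * a)
  set z₀ : ℂ := x + b * I with hz₀
  have hκb : κ * b = Real.pi / 2 := by simp only [κ]; field_simp
  have hrefl : z₀ - 2 * b * I = conj z₀ :=
    Complex.ext (by simp [z₀]) (by simp [z₀]; ring)
  obtain ⟨h1, h2⟩ := mem_ball_and_sub_mem_ball (z := z₀) hab (by simpa [z₀] using hx)
    (by simp [z₀, hb.le])
  have hd : HasDerivAt (fun y : ℝ => (φ (x + y * I) - φ (x + y * I - 2 * b * I)).re +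
      K * Real.cos (κ * y)) (-(2 * (deriv φ z₀).im) + K * (-Real.sin (κ * b) * κ)) b := by
    have hline : HasDerivAt (fun y : ℂ => (x : ℂ) + y * I) I (b : ℂ) := by
      simpa using ((hasDerivAt_id (b : ℂ)).mul_const I).const_add (x : ℂ)
    have hφ₁ := (hφ.differentiableAt (isOpen_ball.mem_nhds h1)).hasDerivAt
    have hφ₂ := (hφ.differentiableAt (isOpen_ball.mem_nhds h2)).hasDerivAt
    have hre := ((hφ₁.sub (hφ₂.comp_sub_const z₀ (2 * b * I))).comp (b : ℂ) hline).real_of_complex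
    refine (hre.add (((hasDerivAt_id b).const_mul κ).cos.const_mul K)).congr_deriv ?_
    rw [mul_I_re, hrefl, deriv_conj_of_symm isOpen_ball hconj h1, sub_im, conj_im, id, mul_one]
    ring
  have hder := deriv_nonpos_of_nonneg_of_eq_zero hb hd
    (by rw [← hz₀, hrefl, hconj _ h1, hκb]; simp) fun y hy => by
      have := neg_mul_cosh_mul_cos_le_re_sub ha hb hab hφ hL hconj hre (z := x + y * I)
        (by simpa using hx) (by simpa using ⟨hy.1.le, hy.2.le⟩)
      simp only [add_re, ofReal_re, re_ofReal_mul, I_re, mul_zero, add_zero, add_im, ofReal_im,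
        im_ofReal_mul, I_im, mul_one, zero_add] at this
      rw [sub_re]
      linarith
  have hKκ : K * κ = 2 * (Real.pi * L / 2 * (Real.cosh (κ * x) / Real.cosh (κ * a))) := by
    simp only [K, hκ]
    field_simp
  rw [hκb, Real.sin_pi_div_two] at hder
  linarith

include ha hb hab hφ hL hconj hre in
lemma neg_mul_exp_le_im_deriv {x : ℝ} (hx : |x| ≤ a / 2) :
    -(Real.pi * L * Real.exp (-(Real.pi * a / (4 * b)))) ≤ (deriv φ (x + b * I)).im := by
  have hL0 : 0 ≤ L := (norm_nonneg _).trans (hL 0 (mem_ball_self (by linarith)))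
  have hκ : 0 < Real.pi / (2 * b) := div_pos Real.pi_pos (by positivity)
  have hcosh := cosh_div_cosh_le (x := Real.pi / (2 * b) * x) (a := Real.pi / (2 * b) * a) (by
    rw [abs_mul, abs_of_pos hκ, mul_div_assoc]
    exact mul_le_mul_of_nonneg_left hx hκ.le)
  have hexp : Real.pi / (2 * b) * a / 2 = Real.pi * a / (4 * b) := by field_simp; norm_num
  rw [hexp] at hcosh
  refine le_trans (neg_le_neg ?_) (neg_mul_cosh_div_cosh_le_im_deriv ha hb hab hφ hL hconj hre
    (hx.trans (by linarith)))
  exact (mul_le_mul_of_nonneg_left hcosh (by positivity)).trans_eq (by ring)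

end

end Reflection

section Logarithm

open Complex Metric Set
open scoped ComplexConjugate

lemma half_lt_log {x : ℝ} (hx : 2 ≤ x) : 1 / 2 < Real.log x := by
  linarith [Real.log_two_gt_d9, Real.log_le_log two_pos hx]

lemma exists_exp_eq_of_ne_zero {f : ℂ → ℂ} {ρ : ℝ} (hρ : 0 < ρ)
    (hf : DifferentiableOn ℂ f (ball 0 ρ)) (h0 : ∀ w ∈ ball (0 : ℂ) ρ, f w ≠ 0) (h1 : f 0 = 1) :
    ∃ φ : ℂ → ℂ, φ 0 = 0 ∧
      ∀ w ∈ ball (0 : ℂ) ρ, HasDerivAt φ (logDeriv f w) w ∧ exp (φ w) = f w := by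
  obtain ⟨φ, hφ0, hφ⟩ :=
    ((hf.deriv isOpen_ball).div hf h0).isExactOn_ball.with_val_at 0 0
  have hder (z : ℂ) (hz : z ∈ ball (0 : ℂ) ρ) : HasDerivAt (fun z => exp (φ z) / f z) 0 z := by
    have hne := h0 z hz
    refine ((hφ z hz).cexp.div (hf.differentiableAt (isOpen_ball.mem_nhds hz)).hasDerivAt
      hne).congr_deriv ?_
    simp only [Pi.div_apply]
    field_simp
    simp
  refine ⟨φ, hφ0, fun w hw => ⟨hφ w hw, ?_⟩⟩
  have hconst := (convex_ball (0 : ℂ) ρ).norm_image_sub_le_of_norm_hasDerivWithin_le (C := 0)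
    (fun z hz => (hder z hz).hasDerivWithinAt) (by simp) (mem_ball_self hρ) hw
  rwa [zero_mul, norm_le_zero_iff, hφ0, h1, exp_zero, div_one, sub_eq_zero,
    div_eq_one_iff_eq (h0 w hw)] at hconst

lemma apply_conj_of_deriv_conj {φ : ℂ → ℂ} {ρ : ℝ} (hφ : DifferentiableOn ℂ φ (ball 0 ρ))
    (hφ0 : φ 0 = 0) (hderiv : ∀ z ∈ ball (0 : ℂ) ρ, deriv φ (conj z) = conj (deriv φ z)) {z : ℂ}
    (hz : z ∈ ball (0 : ℂ) ρ) : φ (conj z) = conj (φ z) := by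
  have hψ : DifferentiableOn ℂ (conj ∘ φ ∘ conj) (ball 0 ρ) := fun w hw =>
    (differentiableAt_conj_conj_iff.2 (hφ.differentiableAt
      (isOpen_ball.mem_nhds (conj_mem_ball_zero hw)))).differentiableWithinAt
  have heq := isOpen_ball.eqOn_of_deriv_eq (convex_ball (0 : ℂ) ρ).isPreconnected hψ hφ
    (fun w hw => by
      rw [deriv_conj_conj, Function.comp_apply, Function.comp_apply, hderiv w hw, conj_conj])
    (mem_ball_self (pos_of_mem_ball hz)) (by simp [hφ0])
  rw [← heq hz, Function.comp_apply, Function.comp_apply, conj_conj]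

lemma norm_sub_quadratic_le_of_norm_deriv_sub_le {φ : ℂ → ℂ} {c v : ℂ} {R C : ℝ} (hC : 0 ≤ C)
    (hφ : ∀ z ∈ closedBall (0 : ℂ) R, DifferentiableAt ℂ φ z)
    (h : ∀ z ∈ closedBall (0 : ℂ) R, ‖deriv φ z - c - v * z‖ ≤ C * ‖z‖ ^ 2) {w : ℂ}
    (hw : ‖w‖ ≤ R) : ‖φ w - φ 0 - c * w - v * w ^ 2 / 2‖ ≤ C * ‖w‖ ^ 3 := by
  have hsub : closedBall (0 : ℂ) ‖w‖ ⊆ closedBall 0 R := closedBall_subset_closedBall hw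
  have hder (z : ℂ) (hz : z ∈ closedBall (0 : ℂ) ‖w‖) :
      HasDerivAt (fun z => φ z - c * z - v * z ^ 2 / 2) (deriv φ z - c - v * z) z := by
    have hlin : HasDerivAt (fun z : ℂ => c * z) c z := by
      simpa using (hasDerivAt_id z).const_mul c
    have hquad : HasDerivAt (fun z : ℂ => v * z ^ 2 / 2) (v * z) z := by
      refine (((hasDerivAt_pow 2 z).const_mul v).div_const 2).congr_deriv ?_
      push_cast
      ring
    exact ((hφ z (hsub hz)).hasDerivAt.sub hlin).sub hquad
  have hmvt := (convex_closedBall (0 : ℂ) ‖w‖).norm_image_sub_le_of_norm_hasDerivWithin_le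
    (C := C * ‖w‖ ^ 2) (fun z hz => (hder z hz).hasDerivWithinAt)
    (fun z hz => (h z (hsub hz)).trans (mul_le_mul_of_nonneg_left
      (pow_le_pow_left₀ (norm_nonneg z) (mem_closedBall_zero_iff.1 hz) 2) hC))
    (mem_closedBall_self (norm_nonneg w)) (mem_closedBall_zero_iff.2 le_rfl)
  calc ‖φ w - φ 0 - c * w - v * w ^ 2 / 2‖
      = ‖φ w - c * w - v * w ^ 2 / 2 - (φ 0 - c * 0 - v * 0 ^ 2 / 2)‖ := by ring_nf
    _ ≤ C * ‖w‖ ^ 2 * ‖w - 0‖ := hmvt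
    _ = C * ‖w‖ ^ 3 := by rw [sub_zero]; ring

section

variable {φ : ℂ → ℂ} {ρ N : ℝ} (hN : 2 ≤ N) (hρ : 0 < ρ) (hφ : DifferentiableOn ℂ φ (ball 0 ρ))
  (hL : ∀ z ∈ ball (0 : ℂ) ρ, ‖deriv φ z‖ ≤ N / ρ)
  (hconj : ∀ z ∈ ball (0 : ℂ) ρ, φ (conj z) = conj (φ z))
  (hre : ∀ z ∈ ball (0 : ℂ) ρ, (φ z).re ≤ (φ z.re).re)

include hN hρ in
lemma div_eight_mul_log_lt : ρ / (8 * Real.log N) < ρ / 4 :=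
  div_lt_div_of_pos_left hρ (by norm_num) (by linarith [half_lt_log hN])

-- The radius `ρ / (8 log N)` is chosen so that the exponential decay absorbs the factor `N`.
include hN hρ hφ hL hconj hre in
lemma neg_four_div_le_im_deriv {z : ℂ} (hz : ‖z‖ ≤ ρ / (8 * Real.log N)) (hzi : 0 ≤ z.im) :
    -(4 / ρ) ≤ (deriv φ z).im := by
  have hr := div_eight_mul_log_lt hN hρ
  have hlog := half_lt_log hN
  have him := (abs_im_le_norm z).trans hz
  rw [abs_of_nonneg hzi] at him
  rcases hzi.eq_or_lt with h0 | hpos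
  · have hreal := deriv_conj_of_symm isOpen_ball hconj
      (mem_ball_zero_iff.2 (hz.trans_lt (hr.trans (by linarith))))
    rw [conj_eq_iff_im.2 h0.symm] at hreal
    rw [conj_eq_iff_im.1 hreal.symm]
    linarith [div_pos four_pos hρ]
  have key := neg_mul_exp_le_im_deriv (a := ρ / 2) (b := z.im) (x := z.re) (half_pos hρ) hpos
    (by linarith) hφ hL hconj hre (by linarith [abs_re_le_norm z])
  rw [re_add_im] at key
  have hexp : Real.exp (-(Real.pi * (ρ / 2) / (4 * z.im))) ≤ 1 / N := by
    rw [one_div, ← Real.exp_log (two_pos.trans_le hN), ← Real.exp_neg, Real.exp_le_exp,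
      neg_le_neg_iff, le_div_iff₀ (by positivity)]
    calc Real.log N * (4 * z.im) ≤ Real.log N * (4 * (ρ / (8 * Real.log N))) := by gcongr
      _ = ρ / 2 := by field_simp; norm_num
      _ ≤ Real.pi * (ρ / 2) :=
        le_mul_of_one_le_left (by positivity) (by linarith [Real.pi_gt_three])
  refine (neg_le_neg ?_).trans key
  calc Real.pi * (N / ρ) * Real.exp (-(Real.pi * (ρ / 2) / (4 * z.im)))
      ≤ Real.pi * (N / ρ) * (1 / N) :=
        mul_le_mul_of_nonneg_left hexp (mul_nonneg Real.pi_pos.le (by positivity))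
    _ = Real.pi / ρ := by field_simp
    _ ≤ 4 / ρ := by gcongr; exact Real.pi_le_four

include hN hρ hφ hL hconj hre in
lemma norm_sub_quadratic_le {v : ℝ} (hv0 : 0 < v) (hv : deriv (deriv φ) 0 = v)
    (hbig : 64 * Real.log N ≤ ρ ^ 2 * v) {w : ℂ} (hw : ‖w‖ ≤ ρ / (16 * Real.log N)) :
    ‖φ w - φ 0 - deriv φ 0 * w - v * w ^ 2 / 2‖ ≤ 96 * v * Real.log N / ρ * ‖w‖ ^ 3 := by
  have hlog := half_lt_log hN
  set r := ρ / (8 * Real.log N) with hr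
  have hr0 : 0 < r := by positivity
  have hrρ : r < ρ := (div_eight_mul_log_lt hN hρ).trans (by linarith)
  have hhalf : ρ / (16 * Real.log N) = r / 2 := by rw [hr]; field_simp; norm_num
  have hsymm (z : ℂ) (hz : z ∈ ball (0 : ℂ) ρ) := deriv_conj_of_symm isOpen_ball hconj hz
  have h0 : (deriv φ 0).im = 0 :=
    conj_eq_iff_im.1 (by rw [← hsymm 0 (mem_ball_self hρ), map_zero])
  have hε : v + 2 * (4 / ρ) / r ≤ 2 * v := by
    have : 2 * (4 / ρ) / r = 64 * Real.log N / ρ ^ 2 := by rw [hr]; field_simp; norm_num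
    rw [this, two_mul]
    gcongr
    rwa [div_le_iff₀' (by positivity)]
  refine norm_sub_quadratic_le_of_norm_deriv_sub_le (by positivity)
    (fun z hz => hφ.differentiableAt (isOpen_ball.mem_nhds ?_)) (fun z hz => ?_) hw
  · rw [mem_closedBall_zero_iff] at hz
    exact mem_ball_zero_iff.2 (by linarith)
  · rw [mem_closedBall_zero_iff, hhalf] at hz
    refine (norm_sub_sub_mul_le_of_neg_le_im hr0 hrρ (hφ.deriv isOpen_ball) h0
      (fun u hu => hsymm u (mem_ball_zero_iff.2 (hu ▸ hrρ)))
      (fun u hu => neg_four_div_le_im_deriv hN hρ hφ hL hconj hre hu.le) (by positivity)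
      hv0 hv hz).trans ?_
    calc 6 * (v + 2 * (4 / ρ) / r) * ‖z‖ ^ 2 / r ≤ 6 * (2 * v) * ‖z‖ ^ 2 / r := by gcongr
      _ = 96 * v * Real.log N / ρ * ‖z‖ ^ 2 := by rw [hr]; field_simp; ring

end

end Logarithm

section ComplexMGF

open Complex Metric Set
open scoped ComplexConjugate

variable {Ω : Type*} [MeasurableSpace Ω] {P : Measure Ω} {X : Ω → ℝ}

lemma complexMGF_conj (z : ℂ) : complexMGF X P (conj z) = conj (complexMGF X P z) := by
  rw [complexMGF, complexMGF, ← integral_conj]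
  simp only [← exp_conj, map_mul, conj_ofReal]

lemma re_mem_interior_integrableExpSet {ρ : ℝ} (hX : Ioo (-ρ) ρ ⊆ integrableExpSet X P) {z : ℂ}
    (hz : z ∈ ball (0 : ℂ) ρ) : z.re ∈ interior (integrableExpSet X P) :=
  interior_maximal hX isOpen_Ioo (abs_lt.1 ((abs_re_le_norm z).trans_lt (mem_ball_zero_iff.1 hz)))

lemma charFun_map_sub_div (hX : AEMeasurable X P) (m s t : ℝ) :
    charFun (P.map fun ω => (X ω - m) / s) t =
      complexMGF X P ((t / s : ℝ) * I) * exp (-(m * ((t / s : ℝ) * I))) := by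
  rw [← complexMGF_mul_I ((hX.sub_const m).div_const s), complexMGF, complexMGF,
    ← integral_mul_const]
  simp_rw [← exp_add]
  refine integral_congr_ae (ae_of_all _ fun ω => congrArg exp ?_)
  push_cast
  ring

lemma norm_exp_sub_exp_le {s B : ℝ} {z : ℂ} (hz : ‖z + s ^ 2 / 2‖ ≤ B) (hB : B ≤ s ^ 2 / 4) :
    ‖exp z - exp (-(s ^ 2 / 2))‖ ≤ B * Real.exp (-(s ^ 2 / 4)) := by
  have hfactor : exp z - exp (-(s ^ 2 / 2)) = exp (-(s ^ 2 / 2)) * (exp (z + s ^ 2 / 2) - 1) := by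
    rw [mul_sub, ← exp_add, mul_one, add_comm z, neg_add_cancel_left]
  have hnorm : ‖exp (-((s : ℂ) ^ 2 / 2))‖ = Real.exp (-(s ^ 2 / 2)) := by
    rw [norm_exp]
    norm_cast
  have hexp : ‖exp (z + s ^ 2 / 2) - 1‖ ≤ B * Real.exp (s ^ 2 / 4) := by
    have h := norm_exp_sub_sum_le_norm_mul_exp (z + s ^ 2 / 2) 1
    simp only [Finset.sum_range_one, pow_zero, Nat.factorial_zero, Nat.cast_one, div_one,
      pow_one] at h
    exact h.trans (mul_le_mul hz (Real.exp_le_exp.2 (hz.trans hB)) (Real.exp_pos _).le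
      ((norm_nonneg _).trans hz))
  calc ‖exp z - exp (-(s ^ 2 / 2))‖
      = Real.exp (-(s ^ 2 / 2)) * ‖exp (z + s ^ 2 / 2) - 1‖ := by rw [hfactor, norm_mul, hnorm]
    _ ≤ Real.exp (-(s ^ 2 / 2)) * (B * Real.exp (s ^ 2 / 4)) := by gcongr
    _ = B * Real.exp (-(s ^ 2 / 4)) := by
      rw [mul_left_comm, ← Real.exp_add]
      ring_nf

variable [IsProbabilityMeasure P]

lemma complexMGF_zero_eq_one : complexMGF X P 0 = 1 := by
  simp [complexMGF]

lemma logDeriv_complexMGF_zero (hX : 0 ∈ interior (integrableExpSet X P)) :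
    logDeriv (complexMGF X P) 0 = (P[X] : ℝ) := by
  rw [logDeriv_apply, (hasDerivAt_complexMGF (by rwa [zero_re])).deriv, complexMGF_zero_eq_one,
    div_one, ← integral_complex_ofReal]
  simp

lemma deriv_logDeriv_complexMGF_zero (hX : 0 ∈ interior (integrableExpSet X P)) :
    deriv (logDeriv (complexMGF X P)) 0 = (Var[X; P] : ℝ) := by
  have hX' : (0 : ℂ).re ∈ interior (integrableExpSet X P) := by rwa [zero_re]
  have h1 := hasDerivAt_complexMGF hX'
  have h2 := hasDerivAt_iteratedDeriv_complexMGF hX' 1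
  rw [iteratedDeriv_one] at h2
  rw [logDeriv, (h2.div h1 (by simp [complexMGF_zero_eq_one])).deriv, h1.deriv,
    complexMGF_zero_eq_one, variance_eq_sub (memLp_of_mem_interior_integrableExpSet hX 2)]
  push_cast
  rw [← integral_complex_ofReal, ← integral_complex_ofReal]
  simp [sq]

section

variable {ρ N : ℝ} (hN : 2 ≤ N) (hρ : 0 < ρ) (hX : Ioo (-ρ) ρ ⊆ integrableExpSet X P)
  (h0 : ∀ z ∈ ball (0 : ℂ) ρ, complexMGF X P z ≠ 0)
  (hL : ∀ z ∈ ball (0 : ℂ) ρ, ‖logDeriv (complexMGF X P) z‖ ≤ N / ρ)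
  (hvar : 0 < Var[X; P])

include hN hρ hX h0 hL hvar in
lemma exists_exp_eq_complexMGF_and_norm_sub_le (hbig : 64 * Real.log N ≤ ρ ^ 2 * Var[X; P]) :
    ∃ φ : ℂ → ℂ, ∀ z : ℂ, ‖z‖ ≤ ρ / (16 * Real.log N) → exp (φ z) = complexMGF X P z ∧
      ‖φ z - (P[X] : ℝ) * z - Var[X; P] * z ^ 2 / 2‖ ≤
        96 * Var[X; P] * Real.log N / ρ * ‖z‖ ^ 3 := by
  have hdiff : DifferentiableOn ℂ (complexMGF X P) (ball 0 ρ) :=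
    differentiableOn_complexMGF.mono fun z hz => re_mem_interior_integrableExpSet hX hz
  have hint : 0 ∈ interior (integrableExpSet X P) := by
    simpa using re_mem_interior_integrableExpSet hX (mem_ball_self hρ)
  obtain ⟨φ, hφ0, hφ⟩ := exists_exp_eq_of_ne_zero hρ hdiff h0 complexMGF_zero_eq_one
  have hφdiff : DifferentiableOn ℂ φ (ball 0 ρ) := fun z hz =>
    (hφ z hz).1.differentiableAt.differentiableWithinAt
  have hderiv : EqOn (deriv φ) (logDeriv (complexMGF X P)) (ball 0 ρ) := fun z hz =>
    (hφ z hz).1.deriv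
  have hmem : (0 : ℂ) ∈ ball 0 ρ := mem_ball_self hρ
  have hderiv2 : deriv (deriv φ) 0 = Var[X; P] := by
    rw [(hderiv.eventuallyEq_of_mem (isOpen_ball.mem_nhds hmem)).deriv_eq,
      deriv_logDeriv_complexMGF_zero hint]
  have hconj (z : ℂ) (hz : z ∈ ball (0 : ℂ) ρ) : φ (conj z) = conj (φ z) := by
    refine apply_conj_of_deriv_conj hφdiff hφ0 (fun w hw => ?_) hz
    rw [hderiv hw, hderiv (conj_mem_ball_zero hw), logDeriv_apply, logDeriv_apply, map_div₀,
      complexMGF_conj, deriv_conj_of_symm isOpen_ball (fun u _ => complexMGF_conj u) hw]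
  have hre (z : ℂ) (hz : z ∈ ball (0 : ℂ) ρ) : (φ z).re ≤ (φ z.re).re := by
    have hz' : (z.re : ℂ) ∈ ball (0 : ℂ) ρ := by
      rw [mem_ball_zero_iff, norm_real]
      exact (abs_re_le_norm z).trans_lt (mem_ball_zero_iff.1 hz)
    rw [← Real.exp_le_exp, ← norm_exp, ← norm_exp, (hφ z hz).2, (hφ _ hz').2, complexMGF_ofReal,
      norm_real, Real.norm_of_nonneg mgf_nonneg]
    exact norm_complexMGF_le_mgf
  have hr : ρ / (16 * Real.log N) < ρ :=
    div_lt_self hρ (by linarith [half_lt_log hN])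
  refine ⟨φ, fun z hz => ⟨(hφ z (mem_ball_zero_iff.2 (hz.trans_lt hr))).2, ?_⟩⟩
  have key := norm_sub_quadratic_le hN hρ hφdiff (fun w hw => by rw [hderiv hw]; exact hL w hw)
    hconj hre hvar hderiv2 hbig hz
  rwa [hφ0, sub_zero, hderiv hmem, logDeriv_complexMGF_zero hint] at key

include hN hρ hX h0 hL hvar in
lemma norm_charFun_sub_charFun_gaussianReal_le (hbig : 64 * Real.log N ≤ ρ ^ 2 * Var[X; P])
    {T : ℝ} (hT : T = ρ * √Var[X; P] / (384 * Real.log N)) {t : ℝ} (ht : t ∈ Ioc 0 T) :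
    ‖charFun (P.map fun ω => (X ω - P[X]) / √Var[X; P]) t - charFun (gaussianReal 0 1) t‖ ≤
      t ^ 3 / (4 * T) * Real.exp (-(t ^ 2 / 4)) := by
  set σ := √Var[X; P]
  have hσ0 : 0 < σ := Real.sqrt_pos.2 hvar
  have hσ2 : Var[X; P] = σ ^ 2 := (Real.sq_sqrt hvar.le).symm
  have hlog : 0 < Real.log N := by linarith [half_lt_log hN]
  have hT0 : 0 < T := ht.1.trans_le ht.2
  set z : ℂ := (t / σ : ℝ) * I with hz
  have hnorm : ‖z‖ = t / σ := by
    rw [hz, norm_mul, norm_I, mul_one, norm_real,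
      Real.norm_of_nonneg (div_nonneg ht.1.le hσ0.le)]
  have hz2 : (σ ^ 2 : ℝ) * z ^ 2 = -(t : ℂ) ^ 2 := by
    rw [hz, mul_pow, I_sq, mul_neg_one, mul_neg, ← ofReal_pow, ← ofReal_mul, div_pow,
      mul_div_cancel₀ _ (by positivity), ofReal_pow]
  obtain ⟨φ, hφ⟩ := exists_exp_eq_complexMGF_and_norm_sub_le hN hρ hX h0 hL hvar hbig
  obtain ⟨hexp, hquad⟩ := hφ z <| by
    calc ‖z‖ ≤ T / σ := by rw [hnorm]; gcongr; exact ht.2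
      _ = ρ / (384 * Real.log N) := by rw [hT]; field_simp
      _ ≤ ρ / (16 * Real.log N) := by gcongr; norm_num
  have hmeas : AEMeasurable X P :=
    aemeasurable_of_mem_interior_integrableExpSet
      (re_mem_interior_integrableExpSet hX (mem_ball_self hρ))
  have hgauss : charFun (gaussianReal 0 1) t = exp (-((t : ℂ) ^ 2 / 2)) := by
    simp [charFun_gaussianReal]
  rw [charFun_map_sub_div hmeas, ← hz, ← hexp, ← exp_add, hgauss]
  refine norm_exp_sub_exp_le ?_ ?_
  · calc ‖φ z + -((P[X] : ℝ) * z) + (t : ℂ) ^ 2 / 2‖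
        = ‖φ z - (P[X] : ℝ) * z - Var[X; P] * z ^ 2 / 2‖ := by
          rw [hσ2, hz2, neg_div, sub_neg_eq_add, ← sub_eq_add_neg]
      _ ≤ 96 * Var[X; P] * Real.log N / ρ * ‖z‖ ^ 3 := hquad
      _ = t ^ 3 / (4 * T) := by rw [hσ2, hnorm, hT]; field_simp; ring
  · calc t ^ 3 / (4 * T) = t ^ 2 * (t / T) / 4 := by field_simp
      _ ≤ t ^ 2 * 1 / 4 := by gcongr; exact div_le_one_of_le₀ ht.2 hT0.le
      _ = t ^ 2 / 4 := by rw [mul_one]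

include hN hρ hX h0 hL hvar in
theorem theorem1_general :
    kolmogorovDist (P.map fun ω => (X ω - P[X]) / √Var[X; P]) (gaussianReal 0 1) ≤
      2 ^ 16 * (Real.log N / (ρ * √Var[X; P])) := by
  have hlog : 1 / 2 < Real.log N := half_lt_log hN
  have hint : (0 : ℝ) ∈ interior (integrableExpSet X P) := by
    simpa using re_mem_interior_integrableExpSet hX (mem_ball_self hρ)
  have hmeas : AEMeasurable (fun ω => (X ω - P[X]) / √Var[X; P]) P :=
    ((aemeasurable_of_mem_interior_integrableExpSet hint).sub_const _).div_const _
  have := Measure.isProbabilityMeasure_map hmeas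
  rcases le_or_gt (64 * Real.log N) (ρ ^ 2 * Var[X; P]) with hbig | hsmall
  · refine (kolmogorovDist_gaussianReal_le_div
      ?_ (T := ρ * √Var[X; P] / (384 * Real.log N)) (by positivity) fun t ht =>
      norm_charFun_sub_charFun_gaussianReal_le hN hρ hX h0 hL hvar hbig rfl ht).trans ?_
    · exact (integrable_map_measure aestronglyMeasurable_id hmeas).2
        (((integrable_of_mem_interior_integrableExpSet hint).sub (integrable_const _)).div_const _)
    · calc 104 / (ρ * √Var[X; P] / (384 * Real.log N))
          = 39936 * (Real.log N / (ρ * √Var[X; P])) := by field_simp; norm_num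
        _ ≤ 2 ^ 16 * (Real.log N / (ρ * √Var[X; P])) := by gcongr; norm_num
  · refine (kolmogorovDist_le_one _ _).trans ?_
    rw [← mul_div_assoc, one_le_div (by positivity)]
    rw [← sq_le_sq₀ (by positivity) (by positivity), mul_pow, Real.sq_sqrt hvar.le]
    nlinarith

end

end ComplexMGF

section GeneratingFunction

open Metric Polynomial Set

lemma norm_eval_derivative_div_eval_le {K : Type*} [NormedField K] [IsAlgClosed K] {p : K[X]}
    {z : K} {ε : ℝ} (hε : 0 < ε) (h : ∀ ζ, p.IsRoot ζ → ε ≤ ‖z - ζ‖) :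
    ‖p.derivative.eval z / p.eval z‖ ≤ p.natDegree / ε := by
  have hz : p.eval z ≠ 0 := fun hz => by simpa using hε.trans_le (h z hz)
  have hterm : ∀ x ∈ (p.roots.map fun ζ => 1 / (z - ζ)).map norm, x ≤ ε⁻¹ := by
    simp only [Multiset.mem_map, exists_exists_and_eq_and, forall_exists_index, and_imp]
    rintro _ ζ hζ rfl
    rw [one_div, norm_inv]
    exact inv_anti₀ hε (h ζ (isRoot_of_mem_roots hζ))
  rw [(IsAlgClosed.splits p).eval_derivative_div_eval_of_ne_zero hz]
  calc ‖(p.roots.map fun ζ => 1 / (z - ζ)).sum‖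
      ≤ ((p.roots.map fun ζ => 1 / (z - ζ)).map norm).sum := norm_multiset_sum_le _
    _ ≤ p.roots.card * ε⁻¹ := by
      simpa using Multiset.sum_le_card_nsmul _ _ hterm
    _ ≤ p.natDegree / ε := by
      rw [div_eq_mul_inv]
      gcongr
      exact p.card_roots'

section

variable {δ : ℝ} (hδ : δ < 1) {w : ℂ} (hw : w ∈ ball (0 : ℂ) (δ / 4))

include hδ hw

lemma norm_one_sub_exp_le : ‖1 - Complex.exp w‖ ≤ δ / 2 := by
  rw [mem_ball_zero_iff] at hw
  rw [norm_sub_rev]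
  exact (Complex.norm_exp_sub_one_le (by linarith)).trans (by linarith)

variable {p : ℂ[X]} (hp : ∀ ζ, p.IsRoot ζ → δ ≤ ‖1 - ζ‖)

include hp

lemma half_le_norm_exp_sub_of_isRoot {ζ : ℂ} (hζ : p.IsRoot ζ) :
    δ / 2 ≤ ‖Complex.exp w - ζ‖ := by
  linarith [hp ζ hζ, norm_one_sub_exp_le hδ hw,
    norm_sub_le_norm_sub_add_norm_sub 1 (Complex.exp w) ζ]

lemma eval_exp_ne_zero : p.eval (Complex.exp w) ≠ 0 := fun h => by
  have := half_le_norm_exp_sub_of_isRoot hδ hw hp h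
  rw [sub_self, norm_zero] at this
  linarith [pos_of_mem_ball hw]

lemma norm_logDeriv_eval_exp_le :
    ‖logDeriv (fun z => p.eval (Complex.exp z)) w‖ ≤ p.natDegree / (δ / 4) := by
  have hδ0 : 0 < δ / 4 := pos_of_mem_ball hw
  have hexp : ‖Complex.exp w‖ ≤ 2 := by
    have := norm_le_norm_add_norm_sub (1 : ℂ) (Complex.exp w)
    rw [norm_one] at this
    linarith [norm_one_sub_exp_le hδ hw]
  have hlog : logDeriv (fun z => p.eval (Complex.exp z)) w =
      p.derivative.eval (Complex.exp w) / p.eval (Complex.exp w) * Complex.exp w := by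
    rw [div_mul_eq_mul_div]
    exact congrArg (· / _) ((p.hasDerivAt _).comp w (Complex.hasDerivAt_exp w)).deriv
  calc ‖logDeriv (fun z => p.eval (Complex.exp z)) w‖
      ≤ p.natDegree / (δ / 2) * 2 := by
        rw [hlog, norm_mul]
        exact mul_le_mul (norm_eval_derivative_div_eval_le (by linarith) fun ζ hζ =>
          half_le_norm_exp_sub_of_isRoot hδ hw hp hζ) hexp (norm_nonneg _)
          (div_nonneg (Nat.cast_nonneg _) (by linarith))
    _ = p.natDegree / (δ / 4) := by field_simp; norm_num

end

variable {Ω : Type*} [MeasurableSpace Ω] {P : Measure Ω} {n : ℕ} {X : Ω → ℕ}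

lemma natDegree_pgf_le : (pgf P n X).natDegree ≤ n :=
  natDegree_sum_le_of_forall_le _ _ fun _ hk =>
    (natDegree_monomial_le _).trans (Finset.mem_range_succ_iff.1 hk)

variable [IsFiniteMeasure P]

lemma complexMGF_natCast_eq_eval_pgf (hX : Measurable X) (hXn : ∀ ω, X ω ≤ n) :
    complexMGF (fun ω => (X ω : ℝ)) P = fun w => (pgf P n X).eval (Complex.exp w) := by
  ext w
  have hsum (ω : Ω) : Complex.exp (w * (X ω : ℝ)) = ∑ k ∈ Finset.range (n + 1),
      {ω | X ω = k}.indicator (fun _ => Complex.exp w ^ k) ω := by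
    simp only [indicator_apply, mem_ofPred_eq, Finset.sum_ite_eq, Finset.mem_range_succ_iff, hXn,
      if_true, ← Complex.exp_nat_mul, mul_comm, Complex.ofReal_natCast]
  have hmeas (k : ℕ) : MeasurableSet {ω | X ω = k} := hX (measurableSet_singleton k)
  simp_rw [complexMGF, hsum]
  rw [integral_finsetSum _ fun k _ => (integrable_const _).indicator (hmeas k), pgf,
    eval_finsetSum]
  refine Finset.sum_congr rfl fun k _ => ?_
  rw [integral_indicator_const _ (hmeas k), Complex.real_smul, eval_monomial]

lemma integrableExpSet_natCast_eq_univ (hX : Measurable X) (hXn : ∀ ω, X ω ≤ n) :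
    integrableExpSet (fun ω => (X ω : ℝ)) P = univ :=
  eq_univ_of_forall fun _ => integrable_exp_mul_of_mem_Icc
    (measurable_from_nat.comp hX).aemeasurable
    (ae_of_all _ fun ω => ⟨Nat.cast_nonneg _, Nat.cast_le.2 (hXn ω)⟩)

section

variable {δ : ℝ} (hX : Measurable X) (hXn : ∀ ω, X ω ≤ n) (hδ : δ < 1)
  (hroots : ∀ ζ, (pgf P n X).IsRoot ζ → δ ≤ ‖1 - ζ‖) {w : ℂ} (hw : w ∈ ball (0 : ℂ) (δ / 4))

include hX hXn hδ hroots hw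

lemma complexMGF_natCast_ne_zero : complexMGF (fun ω => (X ω : ℝ)) P w ≠ 0 := by
  rw [complexMGF_natCast_eq_eval_pgf hX hXn]
  exact eval_exp_ne_zero hδ hw hroots

lemma norm_logDeriv_complexMGF_natCast_le :
    ‖logDeriv (complexMGF (fun ω => (X ω : ℝ)) P) w‖ ≤ n / (δ / 4) := by
  rw [complexMGF_natCast_eq_eval_pgf hX hXn]
  refine (norm_logDeriv_eval_exp_le hδ hw hroots).trans ?_
  have : 0 < δ / 4 := pos_of_mem_ball hw
  gcongr
  exact natDegree_pgf_le

end

end GeneratingFunction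

theorem theorem1 {Ω : Type*} [MeasurableSpace Ω] (P : Measure Ω) [IsProbabilityMeasure P]
    (n : ℕ) (hn : 2 ≤ n) (X : Ω → ℕ) (hX : Measurable X) (hXn : ∀ ω, X ω ≤ n)
    (hσ : 0 < stdDev P X) (δ : ℝ) (hδ0 : 0 < δ) (hδ1 : δ < 1)
    (hroots : ∀ ζ : ℂ, (pgf P n X).IsRoot ζ → δ ≤ ‖1 - ζ‖) :
    kolmogorovDist (P.map (normalized P X)) (gaussianReal 0 1) ≤
      2 ^ 3261 * (Real.log n / (δ * stdDev P X)) := by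
  have := Real.log_natCast_nonneg n
  calc kolmogorovDist (P.map (normalized P X)) (gaussianReal 0 1)
      ≤ 2 ^ 16 * (Real.log n / (δ / 4 * stdDev P X)) :=
        theorem1_general (mod_cast hn) (by linarith)
          (by rw [integrableExpSet_natCast_eq_univ hX hXn]; exact Set.subset_univ _)
          (fun _ hw => complexMGF_natCast_ne_zero hX hXn hδ1 hroots hw)
          (fun _ hw => norm_logDeriv_complexMGF_natCast_le hX hXn hδ1 hroots hw)
          (Real.sqrt_pos.1 hσ)
    _ = 2 ^ 18 * (Real.log n / (δ * stdDev P X)) := by field_simp; ring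
    _ ≤ 2 ^ 3261 * (Real.log n / (δ * stdDev P X)) := by gcongr <;> norm_num
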